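/- Let $k\ge 2$ be an integer, $\alpha=1/k$ and $\theta>0$. Let $S_{1/k}$ denote a nonnegative random variable with Laplace transform $\mathbb{E}[e^{-\lambda S_{1/k}}]=e^{-\lambda^{1/k}}$ for $\lambda>0$. Let $T_{1/k,\theta/k}$ denote a random variable whose law is the probability measure proportional to $t^{-\theta/k}\,\mathbb{P}(S_{1/k}\in dt)$. For $a>0$ let $G_a$ denote a Gamma random variable with shape $a$ and scale $1$. Let $\varrho_{1/k}$ be the probability law on $(0,\infty)$ with density $$\varrho_{1/k}(y)=\frac{\sin(\pi/k)}{\pi}\,\frac{y^{1/k-1}}{y^{2/k}+2y^{1/k}\cos(\pi/k)+1},\qquad y>0,$$ and let $M_{\theta/k}(\varrho_{1/k})=\int_0^\infty x\,D(dx)$, where $D$ is a Dirichlet process with shape parameter (base measure) $\frac{\theta}{k}\varrho_{1/k}$. That is, $D$ is a random probability measure such that for every finite measurable partition $(A_i)$ the vector $(D(A_i))_i$ has the Dirichlet distribution with parameters $\frac{\theta}{k}\varrho_{1/k}(A_i)$ (a coordinate with parameter $0$ being $0$). Then the integral defining $M_{\theta/k}(\varrho_{1/k})$ is almost surely finite and,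 with all random variables that occur together in a product or quotient taken independent, $$M_{\theta/k}(\varrho_{1/k})\overset{d}{=}\frac{S_{1/k}}{T_{1/k,\theta/k}}\overset{d}{=}k^{k}\,S_{1/k}\prod_{j=1}^{k-1}G_{\frac{\theta+j}{k}},$$ and moreover $$\frac{1}{T_{1/k,\theta/k}}\overset{d}{=}k^{k}\prod_{j=1}^{k-1}G_{\frac{\theta+j}{k}}.$$ -/

import Mathlib

open MeasureTheory ProbabilityTheory Set
open scoped ENNReal

noncomputable section

/-- `ν` is the law of a unilateral (positive) `α`-stable random variable `S_α`: a probability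
measure carried by `[0, ∞)` with Laplace transform `E[exp (-s S_α)] = exp (-s ^ α)`. -/
structure IsPositiveStableLaw (α : ℝ) (ν : Measure ℝ) : Prop where
  isProbabilityMeasure : IsProbabilityMeasure ν
  nonneg : ν (Iio 0) = 0
  laplace : ∀ s : ℝ, 0 < s → ∫ x, Real.exp (-(s * x)) ∂ν = Real.exp (-(s ^ α))

/-- The probability measure proportional to `t ^ (-q) ν(dt)`. If `ν` is the law of `S_α`, this is
the law of `T_{α,q}`. -/
def polynomialTilt (q : ℝ) (ν : Measure ℝ) : Measure ℝ :=
  (∫⁻ t, ENNReal.ofReal (t ^ (-q)) ∂ν)⁻¹ • ν.withDensity fun t => ENNReal.ofReal (t ^ (-q))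

/-- The density `ϱ_α` on `(0, ∞)`. -/
def rhoDensity (α y : ℝ) : ℝ :=
  Real.sin (Real.pi * α) / Real.pi *
    (y ^ (α - 1) / (y ^ (2 * α) + 2 * y ^ α * Real.cos (Real.pi * α) + 1))

/-- The probability law on `(0, ∞)` with density `ϱ_α`. -/
def rhoLaw (α : ℝ) : Measure ℝ :=
  (volume.restrict (Ioi 0)).withDensity fun y => ENNReal.ofReal (rhoDensity α y)

/-- The Gamma law with shape `a ≥ 0` and scale `1`, degenerate at `0` if `a = 0`. -/
def gammaLaw (a : ℝ) : Measure ℝ :=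
  if a = 0 then Measure.dirac 0 else gammaMeasure a 1

/-- The Dirichlet distribution with parameters `a i ≥ 0` (not all `0`): the law of
`(g i / ∑ j, g j)_i` for independent Gamma variables `g i` of shapes `a i`. -/
def dirichletDistribution {n : ℕ} (a : Fin n → ℝ) : Measure (Fin n → ℝ) :=
  (Measure.pi fun i => gammaLaw (a i)).map fun g i => g i / ∑ j, g j

/-- The random probability measure `D` on `E` (a Markov kernel from the probability space `Ω`) is a
Dirichlet process with shape parameter `τ H`: for every finite measurable partition
`A 0, …, A (n - 1)` of `E`, the vector `(D (A 0), …, D (A (n - 1)))` has the Dirichlet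
distribution with parameters `τ H(A i)`. -/
def IsDirichletProcess {Ω E : Type*} [MeasurableSpace Ω] [MeasurableSpace E]
    (τ : ℝ) (H : Measure E) (D : Kernel Ω E) (P : Measure Ω) : Prop :=
  IsMarkovKernel D ∧
    ∀ (n : ℕ) (A : Fin n → Set E), (∀ i, MeasurableSet (A i)) →
      Pairwise (fun i j => Disjoint (A i) (A j)) → (⋃ i, A i) = univ →
      HasLaw (fun ω i => (D ω).real (A i))
        (dirichletDistribution fun i => τ * H.real (A i)) P

/-- The mean functional `∫ x D(dx)` of a random measure `D` on the line. -/
def meanFunctional {Ω : Type*} [MeasurableSpace Ω] (D : Kernel Ω ℝ) (ω : Ω) : ℝ :=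
  ∫ x, x ∂(D ω)

end

open Filter Topology

open scoped NNReal

theorem eqOn_complexMGF_of_mgf_eqOn {μ ν : Measure ℝ} {a b : ℝ} (hab : a < b)
    (hμ : ∀ p ∈ Ioo a b, Integrable (fun x => Real.exp (p * x)) μ)
    (hν : ∀ p ∈ Ioo a b, Integrable (fun x => Real.exp (p * x)) ν)
    (h : ∀ p ∈ Ioo a b, mgf id μ p = mgf id ν p) :
    EqOn (complexMGF id μ) (complexMGF id ν) {z : ℂ | z.re ∈ Ioo a b} := by
  have key (κ : Measure ℝ) (hκ : ∀ p ∈ Ioo a b, Integrable (fun x => Real.exp (p * x)) κ) :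
      AnalyticOnNhd ℂ (complexMGF id κ) {z : ℂ | z.re ∈ Ioo a b} := fun z hz =>
    analyticAt_complexMGF (interior_maximal (s := integrableExpSet id κ) hκ isOpen_Ioo hz)
  have hmem : (((a + b) / 2 : ℝ) : ℂ) ∈ {z : ℂ | z.re ∈ Ioo a b} := by
    simp only [mem_ofPred_eq, Complex.ofReal_re, mem_Ioo]
    constructor <;> linarith
  refine (key μ hμ).eqOn_of_preconnected_of_frequently_eq (key ν hν)
    ((convex_Ioo a b).linear_preimage Complex.reLm).isPreconnected hmem ?_
  have hev : ∀ᶠ p : ℝ in 𝓝[≠] ((a + b) / 2), p ∈ Ioo a b :=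
    mem_nhdsWithin_of_mem_nhds (isOpen_Ioo.mem_nhds hmem)
  have htend : Tendsto (fun p : ℝ => (p : ℂ)) (𝓝[≠] ((a + b) / 2))
      (𝓝[≠] (((a + b) / 2 : ℝ) : ℂ)) := by
    refine tendsto_nhdsWithin_of_tendsto_nhds_of_eventually_within _
      (Complex.continuous_ofReal.continuousAt.tendsto.mono_left nhdsWithin_le_nhds) ?_
    filter_upwards [self_mem_nhdsWithin] with p hp
    simpa using fun hh => hp (Complex.ofReal_injective hh)
  refine htend.frequently (Eventually.frequently ?_)
  filter_upwards [hev] with p hp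
  rw [complexMGF_ofReal, complexMGF_ofReal, h p hp]

theorem ext_of_mgf_eqOn_Ioo {μ ν : Measure ℝ} [IsFiniteMeasure μ] [IsFiniteMeasure ν]
    {a b : ℝ} (hab : a < b)
    (hμ : ∀ p ∈ Ioo a b, Integrable (fun x => Real.exp (p * x)) μ)
    (hν : ∀ p ∈ Ioo a b, Integrable (fun x => Real.exp (p * x)) ν)
    (h : ∀ p ∈ Ioo a b, mgf id μ p = mgf id ν p) : μ = ν := by
  have heq := eqOn_complexMGF_of_mgf_eqOn hab hμ hν h
  set c := (a + b) / 2 with hc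
  have hcm : c ∈ Ioo a b := by constructor <;> (rw [hc]; linarith)
  set e : ℝ → ℝ≥0∞ := fun x => ENNReal.ofReal (Real.exp (c * x)) with he
  have hem : Measurable e := by fun_prop
  have hfin (κ : Measure ℝ) (hκ : ∀ p ∈ Ioo a b, Integrable (fun x => Real.exp (p * x)) κ) :
      IsFiniteMeasure (κ.withDensity e) :=
    isFiniteMeasure_withDensity_ofReal (hκ c hcm).2
  have hchar (κ : Measure ℝ) (t : ℝ) :
      charFun (κ.withDensity e) t = complexMGF id κ (c + t * Complex.I) := by
    rw [charFun_apply_real, complexMGF, he,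
      integral_withDensity_eq_integral_toReal_smul (by fun_prop) (by simp)]
    congr with x
    rw [ENNReal.toReal_ofReal (Real.exp_pos _).le, Complex.real_smul, Complex.ofReal_exp,
      ← Complex.exp_add]
    congr 1
    push_cast
    simp only [id]
    ring
  have := hfin μ hμ
  have := hfin ν hν
  have hd : μ.withDensity e = ν.withDensity e := by
    refine Measure.ext_of_charFun ?_
    ext t
    rw [hchar, hchar]
    exact heq (by simpa using hcm)
  have hinv (κ : Measure ℝ) : (κ.withDensity e).withDensity e⁻¹ = κ :=
    withDensity_inv_same hem (ae_of_all _ fun x => by simp [he, Real.exp_pos])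
      (ae_of_all _ fun x => by simp [he])
  rw [← hinv μ, hd, hinv ν]

/-- A finite measure on `(0, ∞)` is determined by its Mellin transform on an open interval. -/
theorem ext_of_mellin_eqOn_Ioo {μ ν : Measure ℝ} [IsFiniteMeasure μ] [IsFiniteMeasure ν]
    (hμ : ∀ᵐ x ∂μ, 0 < x) (hν : ∀ᵐ x ∂ν, 0 < x) {a b : ℝ} (hab : a < b)
    (h : ∀ p ∈ Ioo a b, ∫⁻ x, ENNReal.ofReal (x ^ p) ∂μ = ∫⁻ x, ENNReal.ofReal (x ^ p) ∂ν)
    (hfin : ∀ p ∈ Ioo a b, ∫⁻ x, ENNReal.ofReal (x ^ p) ∂μ ≠ ∞) : μ = ν := by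
  have hlog (κ : Measure ℝ) (hκ : ∀ᵐ x ∂κ, 0 < x) (p : ℝ) :
      ∫⁻ x, ENNReal.ofReal (Real.exp (p * x)) ∂(κ.map Real.log) =
        ∫⁻ x, ENNReal.ofReal (x ^ p) ∂κ := by
    rw [lintegral_map (by fun_prop) Real.measurable_log]
    refine lintegral_congr_ae ?_
    filter_upwards [hκ] with x hx
    rw [Real.rpow_def_of_pos hx, mul_comm]
  have hint (κ : Measure ℝ) (hκ : ∀ᵐ x ∂κ, 0 < x) (p : ℝ)
      (hp : ∫⁻ x, ENNReal.ofReal (x ^ p) ∂κ ≠ ∞) :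
      Integrable (fun x => Real.exp (p * x)) (κ.map Real.log) := by
    refine ⟨by fun_prop, ?_⟩
    rw [hasFiniteIntegral_iff_ofReal (ae_of_all _ fun x => (Real.exp_pos _).le), hlog κ hκ]
    exact hp.lt_top
  have hback (κ : Measure ℝ) (hκ : ∀ᵐ x ∂κ, 0 < x) : (κ.map Real.log).map Real.exp = κ := by
    rw [Measure.map_map Real.measurable_exp Real.measurable_log]
    nth_rewrite 2 [← Measure.map_id (μ := κ)]
    refine Measure.map_congr ?_
    filter_upwards [hκ] with x hx
    simp [Real.exp_log hx]
  have hm : μ.map Real.log = ν.map Real.log := by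
    refine ext_of_mgf_eqOn_Ioo hab (fun p hp => hint μ hμ p (hfin p hp))
      (fun p hp => hint ν hν p (h p hp ▸ hfin p hp)) fun p hp => ?_
    simp only [mgf, id]
    rw [integral_eq_lintegral_of_nonneg_ae (ae_of_all _ fun x => (Real.exp_pos _).le) (by fun_prop),
      integral_eq_lintegral_of_nonneg_ae (ae_of_all _ fun x => (Real.exp_pos _).le) (by fun_prop),
      hlog μ hμ, hlog ν hν, h p hp]
  rw [← hback μ hμ, hm, hback ν hν]

/-- **Gauss's multiplication formula** for the Gamma function, up to the value of the constant. -/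
theorem exists_prod_Gamma_add_div_eq (k : ℕ) (hk : 0 < k) :
    ∃ C : ℝ, 0 < C ∧ ∀ x : ℝ, 0 < x →
      ∏ j ∈ Finset.range k, Real.Gamma ((x + j) / k) = C * (k : ℝ) ^ (-x) * Real.Gamma x := by
  have hk0 : (0 : ℝ) < k := by exact_mod_cast hk
  set g : ℝ → ℝ := fun x => ∏ j ∈ Finset.range k, Real.Gamma ((x + j) / k) with hg
  have harg {x : ℝ} (hx : 0 < x) (j : ℕ) : 0 < (x + j) / k := by positivity
  have hgpos {x : ℝ} (hx : 0 < x) : 0 < g x :=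
    Finset.prod_pos fun j _ => Real.Gamma_pos_of_pos (harg hx j)
  have hrec {x : ℝ} (hx : 0 < x) : g (x + 1) = x / k * g x := by
    obtain ⟨m, rfl⟩ : ∃ m, k = m + 1 := ⟨k - 1, by omega⟩
    have h1 : g (x + 1) =
        (∏ j ∈ Finset.range m, Real.Gamma ((x + (j + 1 : ℕ)) / (m + 1 : ℕ))) *
          Real.Gamma (x / (m + 1 : ℕ) + 1) := by
      simp only [hg]
      rw [Finset.prod_range_succ]
      congr 1
      · refine Finset.prod_congr rfl fun j _ => ?_
        push_cast; ring_nf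
      · congr 1
        push_cast at hk0 ⊢
        field_simp
        ring
    have h2 : g x = (∏ j ∈ Finset.range m, Real.Gamma ((x + (j + 1 : ℕ)) / (m + 1 : ℕ))) *
        Real.Gamma (x / (m + 1 : ℕ)) := by
      simp only [hg]
      rw [Finset.prod_range_succ']
      simp
    rw [h1, h2, Real.Gamma_add_one (by positivity)]
    ring
  set f : ℝ → ℝ := fun x => (k : ℝ) ^ (x - 1) * g x / g 1 with hf
  have hfpos {x : ℝ} (hx : 0 < x) : 0 < f x :=
    div_pos (mul_pos (Real.rpow_pos_of_pos hk0 _) (hgpos hx)) (hgpos one_pos)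
  have hfΓ : EqOn f Real.Gamma (Ioi 0) := by
    refine Real.eq_Gamma_of_log_convex ?_ (fun {y} hy => ?_) hfpos ?_
    · have hlog : EqOn (Real.log ∘ f) (fun x => (∑ j ∈ Finset.range k,
          Real.log (Real.Gamma ((x + j) / k))) + (Real.log k * x + (-Real.log k - Real.log (g 1))))
          (Ioi 0) := by
        intro x hx
        simp only [Function.comp_apply, hf]
        rw [Real.log_div (mul_pos (Real.rpow_pos_of_pos hk0 _) (hgpos hx)).ne' (hgpos one_pos).ne',
          Real.log_mul (Real.rpow_pos_of_pos hk0 _).ne' (hgpos hx).ne', Real.log_rpow hk0]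
        simp only [hg]
        rw [Real.log_prod (fun j _ => (Real.Gamma_pos_of_pos (harg hx j)).ne')]
        ring
      refine ConvexOn.congr (ConvexOn.add ?_ ?_) hlog.symm
      · refine ⟨convex_Ioi 0, fun x hx y hy a b ha hb hab => ?_⟩
        simp only [smul_eq_mul]
        rw [Finset.mul_sum, Finset.mul_sum, ← Finset.sum_add_distrib]
        refine Finset.sum_le_sum fun j _ => ?_
        have := Real.convexOn_log_Gamma.2 (harg hx j) (harg hy j) ha hb hab
        simp only [Function.comp_apply, smul_eq_mul] at this
        convert this using 3
        have : (j : ℝ) = a * j + b * j := by rw [← add_mul, hab, one_mul]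
        field_simp
        linarith
      · refine ⟨convex_Ioi 0, fun x hx y hy a b ha hb hab => le_of_eq ?_⟩
        simp only [smul_eq_mul]
        linear_combination (-(-Real.log k - Real.log (g 1))) * hab
    · simp only [hf]
      rw [hrec hy, show y + 1 - 1 = y - 1 + 1 by ring, Real.rpow_add_one hk0.ne']
      field_simp
    · simp [hf, (hgpos one_pos).ne']
  refine ⟨k * g 1, mul_pos hk0 (hgpos one_pos), fun x hx => ?_⟩
  change g x = _
  rw [← hfΓ hx]
  simp only [hf]
  rw [Real.rpow_sub_one hk0.ne', Real.rpow_neg hk0.le]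
  have := (Real.rpow_pos_of_pos hk0 x).ne'
  have := (hgpos one_pos).ne'
  field_simp

theorem lintegral_comp_rpow_Ioi (g : ℝ → ℝ≥0∞) {p : ℝ} (hp : p ≠ 0) :
    ∫⁻ x in Ioi (0 : ℝ), ENNReal.ofReal (|p| * x ^ (p - 1)) * g (x ^ p) =
      ∫⁻ y in Ioi (0 : ℝ), g y := by
  have a : (· ^ p) '' (Ioi 0) = Ioi (0 : ℝ) := by
    ext x
    constructor
    · rintro ⟨y, hy, rfl⟩
      exact Real.rpow_pos_of_pos hy p
    · exact fun hx => ⟨x ^ (1 / p), Real.rpow_pos_of_pos hx _, by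
        simp [← Real.rpow_mul (le_of_lt hx), hp]⟩
  have := lintegral_image_eq_lintegral_abs_deriv_mul measurableSet_Ioi
    (fun x hx => (Real.hasDerivAt_rpow_const (p := p)
      (Or.inl (mem_Ioi.mp hx).ne')).hasDerivWithinAt)
    ((Real.rpow_left_injOn hp).mono (by intro x hx; exact (mem_Ioi.mp hx).le)) g
  rw [a] at this
  rw [this]
  refine setLIntegral_congr_fun measurableSet_Ioi fun x hx => ?_
  simp only [abs_mul, abs_of_nonneg (Real.rpow_nonneg (le_of_lt hx) (p - 1))]

theorem lintegral_eq_mul_lintegral_comp_mul (g : ℝ → ℝ≥0∞) {t : ℝ} (ht : 0 < t) :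
    ∫⁻ x, g x = ENNReal.ofReal t * ∫⁻ x, g (t * x) := by
  nth_rewrite 1 [← Real.smul_map_volume_mul_left ht.ne']
  rw [lintegral_smul_measure, abs_of_pos ht,
    (measurableEmbedding_mulLeft₀ ht.ne').lintegral_map, smul_eq_mul]

theorem setLIntegral_Ioi_eq_mul_lintegral_comp_mul (g : ℝ → ℝ≥0∞) {t : ℝ} (ht : 0 < t) :
    ∫⁻ x in Ioi 0, g x = ENNReal.ofReal t * ∫⁻ x in Ioi 0, g (t * x) := by
  rw [← lintegral_indicator measurableSet_Ioi, ← lintegral_indicator measurableSet_Ioi,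
    lintegral_eq_mul_lintegral_comp_mul _ ht]
  congr 2 with x
  simp [indicator_apply, ht]

theorem setLIntegral_rpow_mul_exp_neg_mul_rpow {p q b : ℝ} (hp : 0 < p) (hq : 0 < q) (hb : 0 < b) :
    ∫⁻ x in Ioi (0 : ℝ), ENNReal.ofReal (x ^ (q - 1) * Real.exp (-(b * x ^ p))) =
      ENNReal.ofReal (b ^ (-q / p) * (1 / p) * Real.Gamma (q / p)) := by
  have h := integral_rpow_mul_exp_neg_mul_rpow hp (by linarith : -1 < q - 1) hb
  simp only [sub_add_cancel, neg_mul] at h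
  rw [← h, ofReal_integral_eq_lintegral_ofReal]
  · by_contra hcon
    rw [integral_undef hcon] at h
    have : 0 < b ^ (-q / p) * (1 / p) * Real.Gamma (q / p) :=
      mul_pos (by positivity) (Real.Gamma_pos_of_pos (by positivity))
    linarith
  · filter_upwards [ae_restrict_mem measurableSet_Ioi] with x hx
    have := mem_Ioi.mp hx
    positivity

theorem setLIntegral_rpow_mul_exp_neg_mul {q w : ℝ} (hq : 0 < q) (hw : 0 < w) :
    ∫⁻ u in Ioi (0 : ℝ), ENNReal.ofReal (u ^ (q - 1) * Real.exp (-(w * u))) =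
      ENNReal.ofReal (Real.Gamma q * w ^ (-q)) := by
  simpa [mul_comm] using setLIntegral_rpow_mul_exp_neg_mul_rpow one_pos hq hw

theorem setLIntegral_rpow_mul_exp_neg_div {q w : ℝ} (hq : 0 < q) (hw : 0 < w) :
    ∫⁻ u in Ioi (0 : ℝ), ENNReal.ofReal (u ^ (-q - 1) * Real.exp (-(w / u))) =
      ENNReal.ofReal (Real.Gamma q * w ^ (-q)) := by
  rw [← setLIntegral_rpow_mul_exp_neg_mul hq hw,
    ← lintegral_comp_rpow_Ioi _ (by norm_num : (-1 : ℝ) ≠ 0)]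
  refine setLIntegral_congr_fun measurableSet_Ioi fun u hu => ?_
  have hu : 0 < u := hu
  rw [← ENNReal.ofReal_mul (by positivity), ← Real.rpow_mul hu.le, ← mul_assoc, abs_neg, abs_one,
    one_mul, ← Real.rpow_add hu, Real.rpow_neg_one, div_inv_eq_mul]
  ring_nf

theorem lintegral_rpow_gammaMeasure {a p : ℝ} (ha : 0 < a) (hp : 0 < a + p) :
    ∫⁻ x, ENNReal.ofReal (x ^ p) ∂(gammaMeasure a 1) =
      ENNReal.ofReal (Real.Gamma (a + p) / Real.Gamma a) := by
  have hm : Measurable (gammaPDF a 1) := (measurable_gammaPDFReal a 1).ennreal_ofReal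
  have hΓ := Real.Gamma_pos_of_pos ha
  rw [gammaMeasure, lintegral_withDensity_eq_lintegral_mul _ hm (by fun_prop)]
  have h1 : ∫⁻ x, (gammaPDF a 1 * fun x => ENNReal.ofReal (x ^ p)) x =
      ∫⁻ x in Ioi 0, (gammaPDF a 1 * fun x => ENNReal.ofReal (x ^ p)) x := by
    rw [Measure.restrict_congr_set Ioi_ae_eq_Ici, ← lintegral_indicator measurableSet_Ici]
    congr with x
    by_cases hx : 0 ≤ x
    · simp [hx]
    · simp [hx, gammaPDF_of_neg (not_le.mp hx)]
  have h2 := setLIntegral_rpow_mul_exp_neg_mul hp one_pos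
  rw [Real.one_rpow, mul_one] at h2
  rw [h1, div_eq_inv_mul, ENNReal.ofReal_mul (by positivity), ← h2,
    ← lintegral_const_mul _ (by fun_prop)]
  refine setLIntegral_congr_fun measurableSet_Ioi fun x hx => ?_
  have hx : 0 < x := hx
  simp only [Pi.mul_apply]
  rw [gammaPDF_of_nonneg hx.le, ← ENNReal.ofReal_mul (by positivity),
    ← ENNReal.ofReal_mul (by positivity), Real.one_rpow,
    show a + p - 1 = (a - 1) + p by ring, Real.rpow_add hx]
  ring_nf

theorem gammaMeasure_ae_pos (a : ℝ) : ∀ᵐ x ∂(gammaMeasure a 1), 0 < x := by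
  have hm : Measurable (gammaPDF a 1) := (measurable_gammaPDFReal a 1).ennreal_ofReal
  rw [gammaMeasure, ae_withDensity_iff hm]
  have h0 : ∀ᵐ x : ℝ, x ≠ 0 := by simp [ae_iff]
  filter_upwards [h0] with x hx h
  by_contra hcon
  exact h (gammaPDF_of_neg (lt_of_le_of_ne (not_lt.mp hcon) hx))

theorem isProbabilityMeasure_gammaLaw {a : ℝ} (ha : 0 ≤ a) : IsProbabilityMeasure (gammaLaw a) := by
  unfold gammaLaw
  split_ifs with h
  · infer_instance
  · exact isProbabilityMeasure_gammaMeasure (lt_of_le_of_ne ha (Ne.symm h)) one_pos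

theorem gammaLaw_ae_nonneg (a : ℝ) : ∀ᵐ x ∂(gammaLaw a), 0 ≤ x := by
  unfold gammaLaw
  split_ifs with h
  · rw [ae_dirac_eq]; simp
  · exact (gammaMeasure_ae_pos a).mono fun x hx => hx.le

/-- Exponential tilting of a Gamma law amounts to rescaling. -/
theorem gammaLaw_withDensity_exp {a t : ℝ} (ha : 0 ≤ a) (ht : 0 < t) :
    (gammaLaw a).withDensity (fun x => ENNReal.ofReal (Real.exp (-((t - 1) * x)))) =
      ENNReal.ofReal (t ^ (-a)) • (gammaLaw a).map (fun x => x / t) := by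
  unfold gammaLaw
  split_ifs with h
  · subst h
    rw [Measure.map_dirac' (by fun_prop), dirac_withDensity' (by fun_prop)]
    simp
  · have ha : 0 < a := lt_of_le_of_ne ha (Ne.symm h)
    have hΓ := Real.Gamma_pos_of_pos ha
    have hm : Measurable (gammaPDF a 1) := (measurable_gammaPDFReal a 1).ennreal_ofReal
    ext s hs
    rw [Measure.smul_apply, Measure.map_apply (by fun_prop) hs, gammaMeasure,
      ← withDensity_mul _ hm (by fun_prop), withDensity_apply _ hs,
      withDensity_apply _ (hs.preimage (by fun_prop)), ← lintegral_indicator hs,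
      ← lintegral_indicator (hs.preimage (by fun_prop)),
      lintegral_eq_mul_lintegral_comp_mul (indicator _ (gammaPDF a 1)) ht, smul_eq_mul,
      ← mul_assoc, ← ENNReal.ofReal_mul (by positivity),
      ← lintegral_const_mul' _ _ ENNReal.ofReal_ne_top]
    congr with y
    by_cases hy : y ∈ s
    · have hy' : t * y ∈ (fun x => x / t) ⁻¹' s := by
        rwa [mem_preimage, mul_div_cancel_left₀ _ ht.ne']
      rw [indicator_of_mem hy, indicator_of_mem hy', Pi.mul_apply]
      by_cases h0 : 0 ≤ y
      · rw [gammaPDF_of_nonneg h0, gammaPDF_of_nonneg (by positivity),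
          ← ENNReal.ofReal_mul (by positivity), ← ENNReal.ofReal_mul (by positivity)]
        congr 1
        have hexp : Real.exp (-(1 * y)) * Real.exp (-((t - 1) * y)) =
            Real.exp (-(1 * (t * y))) := by
          rw [← Real.exp_add]
          ring_nf
        have hpow : t ^ (-a) * t * t ^ (a - 1) = 1 := by
          rw [← Real.rpow_add_one ht.ne', ← Real.rpow_add ht]
          simp
        rw [Real.one_rpow, Real.mul_rpow ht.le h0, mul_assoc, hexp]
        linear_combination (-(1 / Real.Gamma a * y ^ (a - 1) * Real.exp (-(1 * (t * y))))) * hpow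
      · rw [gammaPDF_of_neg (not_le.mp h0),
          gammaPDF_of_neg (mul_neg_of_pos_of_neg ht (not_le.mp h0))]
        simp
    · have hy' : t * y ∉ (fun x => x / t) ⁻¹' s := by
        rwa [mem_preimage, mul_div_cancel_left₀ _ ht.ne']
      rw [indicator_of_notMem hy, indicator_of_notMem hy', mul_zero]

theorem lintegral_pi_prod {ι : Type*} [Fintype ι] (m : ι → Measure ℝ)
    [∀ i, IsProbabilityMeasure (m i)] (h : ι → ℝ → ℝ≥0∞) (hh : ∀ i, Measurable (h i)) :
    ∫⁻ x, ∏ i, h i (x i) ∂(Measure.pi m) = ∏ i, ∫⁻ x, h i x ∂(m i) := by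
  rw [lintegral_prod_eq_prod_lintegral_of_indepFun Finset.univ (fun i (x : ι → ℝ) => h i (x i))
    (iIndepFun_pi fun i => (hh i).aemeasurable) fun i => (hh i).comp (measurable_pi_apply i)]
  refine Finset.prod_congr rfl fun i _ => ?_
  exact (measurePreserving_eval m i).lintegral_comp (hh i)

theorem pi_withDensity {ι : Type*} [Fintype ι] (m : ι → Measure ℝ)
    [∀ i, IsProbabilityMeasure (m i)] (h : ι → ℝ → ℝ≥0∞) (hh : ∀ i, Measurable (h i))
    [∀ i, SigmaFinite ((m i).withDensity (h i))] :
    Measure.pi (fun i => (m i).withDensity (h i)) =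
      (Measure.pi m).withDensity fun x => ∏ i, h i (x i) := by
  refine Measure.pi_eq fun s hs => ?_
  rw [withDensity_apply _ (MeasurableSet.univ_pi hs),
    ← lintegral_indicator (MeasurableSet.univ_pi hs)]
  simp_rw [withDensity_apply _ (hs _), ← lintegral_indicator (hs _)]
  rw [← lintegral_pi_prod m _ fun i => (hh i).indicator (hs i)]
  congr with x
  by_cases hx : x ∈ univ.pi s
  · rw [indicator_of_mem hx]
    exact Finset.prod_congr rfl fun i _ => (indicator_of_mem (hx i (mem_univ i)) _).symm
  · rw [indicator_of_notMem hx]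
    simp only [mem_univ_pi, not_forall] at hx
    obtain ⟨i, hi⟩ := hx
    exact (Finset.prod_eq_zero (Finset.mem_univ i) (indicator_of_notMem hi _)).symm

/-- Joint exponential tilting of independent Gamma variables amounts to rescaling them. -/
theorem lintegral_pi_gammaLaw_mul_exp {ι : Type*} [Fintype ι] {a t : ι → ℝ} (ha : ∀ i, 0 ≤ a i)
    (ht : ∀ i, 0 < t i) {f : (ι → ℝ) → ℝ≥0∞} (hf : Measurable f) :
    ∫⁻ g, ENNReal.ofReal (Real.exp (-∑ i, (t i - 1) * g i)) * f g
        ∂(Measure.pi fun i => gammaLaw (a i)) =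
      ENNReal.ofReal (∏ i, t i ^ (-a i)) *
        ∫⁻ g, f (fun i => g i / t i) ∂(Measure.pi fun i => gammaLaw (a i)) := by
  have := fun i => isProbabilityMeasure_gammaLaw (ha i)
  have heq := fun i => gammaLaw_withDensity_exp (ha i) (ht i)
  have hfin (i) : IsFiniteMeasure ((gammaLaw (a i)).withDensity
      fun x => ENNReal.ofReal (Real.exp (-((t i - 1) * x)))) := by
    rw [heq i]
    exact Measure.smul_finite _ ENNReal.ofReal_ne_top
  have hpi := pi_withDensity (fun i => gammaLaw (a i))
    (fun i x => ENNReal.ofReal (Real.exp (-((t i - 1) * x)))) fun i => by fun_prop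
  have hpi2 : Measure.pi (fun i => (gammaLaw (a i)).withDensity
      fun x => ENNReal.ofReal (Real.exp (-((t i - 1) * x)))) =
      ENNReal.ofReal (∏ i, t i ^ (-a i)) •
        (Measure.pi fun i => gammaLaw (a i)).map (fun g i => g i / t i) := by
    refine Measure.pi_eq fun s hs => ?_
    rw [Measure.smul_apply, Measure.map_apply (by fun_prop) (MeasurableSet.univ_pi hs),
      show (fun (g : ι → ℝ) i => g i / t i) ⁻¹' (univ.pi s) =
        univ.pi fun i => (fun x => x / t i) ⁻¹' (s i) by ext; simp, Measure.pi_pi, smul_eq_mul,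
      ENNReal.ofReal_prod_of_nonneg (fun i _ => by have := ht i; positivity),
      ← Finset.prod_mul_distrib]
    refine Finset.prod_congr rfl fun i _ => ?_
    rw [heq i, Measure.smul_apply, Measure.map_apply (by fun_prop) (hs i), smul_eq_mul]
  rw [hpi] at hpi2
  have hprod (g : ι → ℝ) : ∏ i, ENNReal.ofReal (Real.exp (-((t i - 1) * g i))) =
      ENNReal.ofReal (Real.exp (-∑ i, (t i - 1) * g i)) := by
    rw [← ENNReal.ofReal_prod_of_nonneg (fun i _ => (Real.exp_pos _).le), ← Real.exp_sum,
      Finset.sum_neg_distrib]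
  simp_rw [hprod] at hpi2
  have h3 := congrArg (fun κ => ∫⁻ g, f g ∂κ) hpi2
  rw [lintegral_withDensity_eq_lintegral_mul _ (by fun_prop) hf, lintegral_smul_measure,
    lintegral_map hf (by fun_prop)] at h3
  exact h3

/-- The Markov-Krein identity for the Dirichlet distribution. -/
theorem lintegral_pi_gammaLaw_ratio {ι : Type*} [Fintype ι] {a b : ι → ℝ} (ha : ∀ i, 0 ≤ a i)
    (hb : ∀ i, 0 < b i) (hsum : 0 < ∑ i, a i) :
    ∫⁻ g, ENNReal.ofReal (((∑ i, b i * g i) / ∑ i, g i) ^ (-∑ i, a i))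
        ∂(Measure.pi fun i => gammaLaw (a i)) =
      ENNReal.ofReal (∏ i, b i ^ (-a i)) := by
  have := fun i => isProbabilityMeasure_gammaLaw (ha i)
  set τ := ∑ i, a i with hτ
  set P := Measure.pi fun i => gammaLaw (a i) with hP
  have hΓ := Real.Gamma_pos_of_pos hsum
  have hpos : ∀ᵐ g ∂P, (∀ i, 0 ≤ g i) ∧ ∃ i, 0 < g i := by
    obtain ⟨i, -, hi⟩ : ∃ i ∈ Finset.univ, 0 < a i :=
      Finset.exists_lt_of_sum_lt (by simpa using hsum)
    have h1 : ∀ᵐ g ∂P, 0 < g i := by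
      refine (measurePreserving_eval (fun i => gammaLaw (a i)) i).quasiMeasurePreserving.ae
        (p := fun x => 0 < x) ?_
      rw [gammaLaw, if_neg hi.ne']
      exact gammaMeasure_ae_pos _
    have h2 : ∀ᵐ g ∂P, ∀ i, 0 ≤ g i := by
      rw [ae_all_iff]
      intro i
      exact (measurePreserving_eval (fun i => gammaLaw (a i)) i).quasiMeasurePreserving.ae
        (p := fun x => 0 ≤ x) (gammaLaw_ae_nonneg _)
    filter_upwards [h1, h2] with g hg1 hg2 using ⟨hg2, i, hg1⟩
  have hsumpos {g c : ι → ℝ} (hg : (∀ i, 0 ≤ g i) ∧ ∃ i, 0 < g i) (hc : ∀ i, 0 < c i) :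
      0 < ∑ i, c i * g i := by
    obtain ⟨hg, i, hi⟩ := hg
    exact Finset.sum_pos' (fun i _ => mul_nonneg (hc i).le (hg i))
      ⟨i, Finset.mem_univ i, mul_pos (hc i) hi⟩
  have hmain : ENNReal.ofReal (Real.Gamma τ) *
      ∫⁻ g, ENNReal.ofReal (((∑ i, b i * g i) / ∑ i, g i) ^ (-τ)) ∂P =
      ENNReal.ofReal (Real.Gamma τ) * ENNReal.ofReal (∏ i, b i ^ (-a i)) := by
    calc ENNReal.ofReal (Real.Gamma τ) *
        ∫⁻ g, ENNReal.ofReal (((∑ i, b i * g i) / ∑ i, g i) ^ (-τ)) ∂P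
        = ∫⁻ g, (∫⁻ u in Ioi (0 : ℝ), ENNReal.ofReal ((∑ i, g i) ^ τ) *
            ENNReal.ofReal (u ^ (τ - 1) * Real.exp (-((∑ i, b i * g i) * u)))) ∂P := by
          rw [← lintegral_const_mul _ (by fun_prop)]
          refine lintegral_congr_ae ?_
          filter_upwards [hpos] with g hg
          have h1 : 0 < ∑ i, g i := by simpa using hsumpos hg (c := fun _ => 1) (by simp)
          have h2 := hsumpos hg hb
          rw [lintegral_const_mul _ (by fun_prop), setLIntegral_rpow_mul_exp_neg_mul hsum h2,
            ← ENNReal.ofReal_mul hΓ.le, ← ENNReal.ofReal_mul (by positivity),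
            Real.div_rpow h2.le h1.le, Real.rpow_neg h1.le]
          congr 1
          field_simp
      _ = ∫⁻ u in Ioi (0 : ℝ), ∫⁻ g, ENNReal.ofReal ((∑ i, g i) ^ τ) *
            ENNReal.ofReal (u ^ (τ - 1) * Real.exp (-((∑ i, b i * g i) * u))) ∂P := by
          refine lintegral_lintegral_swap (Measurable.aemeasurable ?_)
          fun_prop
      _ = ∫⁻ u in Ioi (0 : ℝ), ENNReal.ofReal (∏ i, b i ^ (-a i)) *
            ∫⁻ g, ENNReal.ofReal ((∑ i, g i / b i) ^ τ) *
              ENNReal.ofReal (u ^ (-τ - 1) * Real.exp (-((∑ i, g i / b i) / u))) ∂P := by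
          refine setLIntegral_congr_fun measurableSet_Ioi fun u hu => ?_
          have hu : 0 < u := hu
          have h := lintegral_pi_gammaLaw_mul_exp ha (t := fun i => u * b i)
            (fun i => mul_pos hu (hb i)) (f := fun g => ENNReal.ofReal ((∑ i, g i) ^ τ) *
              ENNReal.ofReal (u ^ (τ - 1) * Real.exp (-∑ i, g i))) (by fun_prop)
          have hl : ∫⁻ g, ENNReal.ofReal ((∑ i, g i) ^ τ) *
              ENNReal.ofReal (u ^ (τ - 1) * Real.exp (-((∑ i, b i * g i) * u))) ∂P =
              ∫⁻ g, ENNReal.ofReal (Real.exp (-∑ i, (u * b i - 1) * g i)) *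
              (ENNReal.ofReal ((∑ i, g i) ^ τ) *
              ENNReal.ofReal (u ^ (τ - 1) * Real.exp (-∑ i, g i))) ∂P := by
            congr with g
            rw [mul_left_comm, ← ENNReal.ofReal_mul (Real.exp_pos _).le, mul_left_comm,
              ← Real.exp_add, ← neg_add, ← Finset.sum_add_distrib, Finset.sum_mul]
            congr 5
            refine Finset.sum_congr rfl fun i _ => by ring
          rw [hl, h]
          have hprod : ∏ i, (u * b i) ^ (-a i) = u ^ (-τ) * ∏ i, b i ^ (-a i) := by
            rw [hτ, ← Finset.sum_neg_distrib, Real.rpow_sum_of_pos hu, ← Finset.prod_mul_distrib]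
            exact Finset.prod_congr rfl fun i _ => Real.mul_rpow hu.le (hb i).le
          rw [hprod, mul_comm (u ^ (-τ)), ENNReal.ofReal_mul
            (Finset.prod_nonneg fun i _ => Real.rpow_nonneg (hb i).le _), mul_assoc,
            ← lintegral_const_mul _ (by fun_prop)]
          congr 1
          refine lintegral_congr_ae ?_
          filter_upwards [hpos] with g hg
          have h2 : 0 < ∑ i, g i / b i := by
            simpa [div_eq_inv_mul] using hsumpos hg (c := fun i => (b i)⁻¹)
              (fun i => inv_pos.mpr (hb i))
          have h3 : ∑ i, g i / (u * b i) = (∑ i, g i / b i) / u := by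
            rw [Finset.sum_div]
            exact Finset.sum_congr rfl fun i _ => by rw [div_div, mul_comm]
          rw [h3, ← ENNReal.ofReal_mul (by positivity), ← ENNReal.ofReal_mul (by positivity),
            ← ENNReal.ofReal_mul (by positivity), Real.div_rpow h2.le hu.le,
            Real.rpow_sub_one hu.ne', Real.rpow_sub_one hu.ne', Real.rpow_neg hu.le]
          congr 1
          have := (Real.rpow_pos_of_pos hu τ).ne'
          field_simp
      _ = ENNReal.ofReal (∏ i, b i ^ (-a i)) * ∫⁻ g, (∫⁻ u in Ioi (0 : ℝ),
            ENNReal.ofReal ((∑ i, g i / b i) ^ τ) *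
              ENNReal.ofReal (u ^ (-τ - 1) * Real.exp (-((∑ i, g i / b i) / u)))) ∂P := by
          rw [lintegral_const_mul' _ _ ENNReal.ofReal_ne_top]
          congr 1
          refine lintegral_lintegral_swap (Measurable.aemeasurable ?_)
          fun_prop
      _ = ENNReal.ofReal (∏ i, b i ^ (-a i)) * ∫⁻ g, ENNReal.ofReal (Real.Gamma τ) ∂P := by
          congr 1
          refine lintegral_congr_ae ?_
          filter_upwards [hpos] with g hg
          have h2 : 0 < ∑ i, g i / b i := by
            simpa [div_eq_inv_mul] using hsumpos hg (c := fun i => (b i)⁻¹)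
              (fun i => inv_pos.mpr (hb i))
          rw [lintegral_const_mul _ (by fun_prop), setLIntegral_rpow_mul_exp_neg_div hsum h2,
            ← ENNReal.ofReal_mul (by positivity), Real.rpow_neg h2.le]
          congr 1
          have := (Real.rpow_pos_of_pos h2 τ).ne'
          field_simp
      _ = _ := by
          rw [lintegral_const, hP, measure_univ, mul_one, mul_comm]
  exact (ENNReal.mul_right_inj (by simpa using hΓ) ENNReal.ofReal_ne_top).mp hmain

theorem tendsto_intervalIntegral_vertical {l : Filter ℝ} [l.IsCountablyGenerated] {G : ℂ → ℂ}
    {L : ℂ} {c : ℝ} (hG : ∀ x : ℝ, ContinuousOn (fun y : ℝ => G (x + y * Complex.I)) (Icc (-c) c))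
    (hc : 0 ≤ c) (hL : Tendsto G (comap Complex.re l) (𝓝 L)) :
    Tendsto (fun R : ℝ => ∫ y in (-c)..c, G (R + y * Complex.I)) l (𝓝 (2 * c * L)) := by
  have hcc : -c ≤ c := by linarith
  have hlim : 2 * c * L = ∫ _ in (-c)..c, L := by
    rw [intervalIntegral.integral_const]
    simp only [Complex.real_smul]
    push_cast
    ring
  rw [hlim]
  have htend (y : ℝ) : Tendsto (fun R : ℝ => (R + y * Complex.I : ℂ)) l (comap Complex.re l) := by
    rw [tendsto_comap_iff]
    refine tendsto_id.congr fun R => ?_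
    simp
  refine intervalIntegral.tendsto_integral_filter_of_dominated_convergence (fun _ => ‖L‖ + 1)
    (Eventually.of_forall fun R => ?_) ?_ intervalIntegrable_const
    (ae_of_all _ fun y _ => hL.comp (htend y))
  · rw [uIoc_of_le hcc]
    exact ((hG R).mono Ioc_subset_Icc_self).aestronglyMeasurable measurableSet_Ioc
  · have hb : ∀ᶠ z in comap Complex.re l, ‖G z‖ ≤ ‖L‖ + 1 :=
      hL.norm.eventually (eventually_le_nhds (by linarith))
    obtain ⟨t, ht, hts⟩ := mem_comap.mp hb
    filter_upwards [ht] with R hR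
    refine ae_of_all _ fun y _ => hts ?_
    simpa using hR

theorem one_add_cexp_ne_zero {z : ℂ} (hz : |z.im| < Real.pi) : 1 + Complex.exp z ≠ 0 := by
  intro h
  have h1 : Complex.exp z = Complex.exp (Real.pi * Complex.I) := by
    rw [Complex.exp_pi_mul_I]
    linear_combination h
  obtain ⟨n, rfl⟩ := Complex.exp_eq_exp_iff_exists_int.mp h1
  have h2 : ((Real.pi : ℂ) * Complex.I + n * (2 * Real.pi * Complex.I)).im =
      Real.pi * ((1 + 2 * n : ℤ) : ℝ) := by
    simp
    ring
  rw [h2, abs_mul, abs_of_pos Real.pi_pos, mul_lt_iff_lt_one_right Real.pi_pos] at hz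
  have h3 : |1 + 2 * n| < 1 := by exact_mod_cast hz
  rw [Int.abs_lt_one_iff] at h3
  omega

theorem one_sub_mul_cexp_ne_zero {s : ℝ} (hs : 0 < s) {z : ℂ} (hz : |z.im| ≤ Real.pi)
    (hne : z ≠ ((-Real.log s : ℝ) : ℂ)) : 1 - s * Complex.exp z ≠ 0 := by
  intro h
  have hs' : (s : ℂ) ≠ 0 := by exact_mod_cast hs.ne'
  have h1 : Complex.exp z = Complex.exp ((-Real.log s : ℝ) : ℂ) := by
    rw [← Complex.ofReal_exp, Real.exp_neg, Real.exp_log hs]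
    push_cast
    field_simp
    linear_combination -h
  obtain ⟨n, rfl⟩ := Complex.exp_eq_exp_iff_exists_int.mp h1
  have h2 : (((-Real.log s : ℝ) : ℂ) + n * (2 * Real.pi * Complex.I)).im =
      Real.pi * ((2 * n : ℤ) : ℝ) := by
    simp
    ring
  rw [h2, abs_mul, abs_of_pos Real.pi_pos, mul_le_iff_le_one_right Real.pi_pos] at hz
  have h3 : |2 * n| ≤ 1 := by exact_mod_cast hz
  have hn : n = 0 := by
    rw [abs_le] at h3
    omega
  simp [hn] at hne

theorem ofReal_exp_mul_rhoDensity {α : ℝ} (h0 : 0 < α) (h1 : α < 1) (x : ℝ) :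
    (1 + Complex.exp (α * (x + (-Real.pi : ℝ) * Complex.I)))⁻¹ -
      (1 + Complex.exp (α * (x + (Real.pi : ℝ) * Complex.I)))⁻¹ =
      2 * Real.pi * Complex.I * ((Real.exp x * rhoDensity α (Real.exp x) : ℝ) : ℂ) := by
  have hA : 1 + Complex.exp (α * (x + (-Real.pi : ℝ) * Complex.I)) ≠ 0 := by
    refine one_add_cexp_ne_zero ?_
    simp only [Complex.mul_im, Complex.ofReal_re, Complex.add_im, Complex.ofReal_im,
      Complex.I_im, Complex.I_re, Complex.add_re]
    simp [abs_of_pos h0, abs_of_pos Real.pi_pos, h1, Real.pi_pos]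
  have hB : 1 + Complex.exp (α * (x + (Real.pi : ℝ) * Complex.I)) ≠ 0 := by
    refine one_add_cexp_ne_zero ?_
    simp [abs_mul, abs_of_pos h0, abs_of_pos Real.pi_pos, h1, Real.pi_pos]
  set E : ℝ := Real.exp (α * x) with hE
  have hEpos : 0 < E := Real.exp_pos _
  set co := Real.cos (Real.pi * α)
  set si := Real.sin (Real.pi * α)
  have hsc : si ^ 2 + co ^ 2 = 1 := Real.sin_sq_add_cos_sq _
  have e1 : Complex.exp (α * (x + (-Real.pi : ℝ) * Complex.I)) = E * (co - si * Complex.I) := by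
    rw [hE, Complex.ofReal_exp, show (α : ℂ) * (x + (-Real.pi : ℝ) * Complex.I) =
      ((α * x : ℝ) : ℂ) + ((-(Real.pi * α) : ℝ) : ℂ) * Complex.I by push_cast; ring,
      Complex.exp_add, Complex.exp_mul_I, ← Complex.ofReal_cos, ← Complex.ofReal_sin,
      Real.cos_neg, Real.sin_neg, show Real.cos (Real.pi * α) = co from rfl,
      show Real.sin (Real.pi * α) = si from rfl]
    push_cast
    ring
  have e2 : Complex.exp (α * (x + (Real.pi : ℝ) * Complex.I)) = E * (co + si * Complex.I) := by
    rw [hE, Complex.ofReal_exp, show (α : ℂ) * (x + (Real.pi : ℝ) * Complex.I) =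
      ((α * x : ℝ) : ℂ) + (((Real.pi * α) : ℝ) : ℂ) * Complex.I by push_cast; ring,
      Complex.exp_add, Complex.exp_mul_I, ← Complex.ofReal_cos, ← Complex.ofReal_sin]
  rw [e1] at hA
  rw [e2] at hB
  rw [e1, e2, inv_sub_inv hA hB]
  have hD : (1 + E * (co - si * Complex.I)) * (1 + E * (co + si * Complex.I)) =
      ((E ^ 2 + 2 * E * co + 1 : ℝ) : ℂ) := by
    have hsc' : (si : ℂ) ^ 2 + (co : ℂ) ^ 2 = 1 := by exact_mod_cast hsc
    push_cast
    linear_combination (E : ℂ) ^ 2 * hsc' - (E : ℂ) ^ 2 * (si : ℂ) ^ 2 * Complex.I_sq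
  have hq : Real.exp x * rhoDensity α (Real.exp x) =
      si / Real.pi * (E / (E ^ 2 + 2 * E * co + 1)) := by
    have h2 : Real.exp x * Real.exp x ^ (α - 1) = E := by
      rw [← Real.exp_mul, ← Real.exp_add, hE]
      ring_nf
    have h3 : Real.exp x ^ (2 * α) = E ^ 2 := by
      rw [← Real.exp_mul, hE, ← Real.exp_nat_mul]
      push_cast
      ring_nf
    have h4 : Real.exp x ^ α = E := by rw [← Real.exp_mul, hE, mul_comm]
    rw [rhoDensity, h3, h4]
    rw [← h2]
    ring
  have hDne : ((E ^ 2 + 2 * E * co + 1 : ℝ) : ℂ) ≠ 0 := hD ▸ mul_ne_zero hA hB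
  rw [hD, hq]
  have hpi : (Real.pi : ℂ) ≠ 0 := by exact_mod_cast Real.pi_ne_zero
  rw [div_eq_iff hDne]
  generalize E ^ 2 + 2 * E * co + 1 = d at *
  push_cast
  field_simp
  ring

theorem rhoDensity_nonneg {α y : ℝ} (h0 : 0 < α) (h1 : α < 1) (hy : 0 < y) :
    0 ≤ rhoDensity α y := by
  have hs : 0 ≤ Real.sin (Real.pi * α) :=
    Real.sin_nonneg_of_nonneg_of_le_pi (by positivity) (by nlinarith [Real.pi_pos])
  have h2 : y ^ (2 * α) = (y ^ α) ^ 2 := by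
    rw [mul_comm, Real.rpow_mul hy.le]
    norm_num
  have h3 : 0 ≤ y ^ (2 * α) + 2 * y ^ α * Real.cos (Real.pi * α) + 1 := by
    rw [h2]
    nlinarith [Real.sin_sq_add_cos_sq (Real.pi * α), sq_nonneg (y ^ α + Real.cos (Real.pi * α)),
      sq_nonneg (Real.sin (Real.pi * α))]
  have := Real.pi_pos
  have : 0 ≤ y ^ (α - 1) := Real.rpow_nonneg hy.le _
  unfold rhoDensity
  positivity

theorem continuous_exp_mul_rhoDensity {α : ℝ} (h0 : 0 < α) (h1 : α < 1) :
    Continuous fun x : ℝ => Real.exp x * rhoDensity α (Real.exp x) := by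
  have h (x : ℝ) := ofReal_exp_mul_rhoDensity h0 h1 x
  have hpi : (Real.pi : ℂ) ≠ 0 := by exact_mod_cast Real.pi_ne_zero
  have heq : (fun x : ℝ => Real.exp x * rhoDensity α (Real.exp x)) = fun x : ℝ =>
      (((1 + Complex.exp (α * (x + (-Real.pi : ℝ) * Complex.I)))⁻¹ -
      (1 + Complex.exp (α * (x + (Real.pi : ℝ) * Complex.I)))⁻¹) /
        (2 * Real.pi * Complex.I)).re := by
    funext x
    rw [h x, mul_div_cancel_left₀ _ (by simp [hpi]), Complex.ofReal_re]
  rw [heq]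
  refine Complex.continuous_re.comp (Continuous.div_const (Continuous.sub ?_ ?_) _)
  · refine Continuous.inv₀ (by fun_prop) fun x => one_add_cexp_ne_zero ?_
    simp only [Complex.mul_im, Complex.ofReal_re, Complex.add_im, Complex.ofReal_im,
      Complex.I_im, Complex.I_re, Complex.add_re]
    simp [abs_of_pos h0, abs_of_pos Real.pi_pos, h1, Real.pi_pos]
  · refine Continuous.inv₀ (by fun_prop) fun x => one_add_cexp_ne_zero ?_
    simp [abs_mul, abs_of_pos h0, abs_of_pos Real.pi_pos, h1, Real.pi_pos]

theorem tendsto_intervalIntegral_exp_mul_rhoDensity {α s : ℝ} (h0 : 0 < α) (h1 : α < 1)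
    (hs : 0 < s) :
    Tendsto (fun R : ℝ => ∫ x in (-R)..R,
      Real.exp x * rhoDensity α (Real.exp x) / (1 + s * Real.exp x)) atTop
      (𝓝 (1 / (1 + s ^ α))) := by
  set w₀ : ℂ := ((-Real.log s : ℝ) : ℂ) with hw₀
  set f : ℂ → ℂ := fun w => (1 + Complex.exp (α * w))⁻¹ with hf
  set h : ℂ → ℂ := fun w => 1 - s * Complex.exp w with hh
  set G : ℂ → ℂ := fun w => dslope f w₀ w / dslope h w₀ w with hG
  have hs' : (s : ℂ) ≠ 0 := by exact_mod_cast hs.ne'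
  have hexp0 : (s : ℂ) * Complex.exp w₀ = 1 := by
    rw [hw₀, ← Complex.ofReal_exp, Real.exp_neg, Real.exp_log hs]
    push_cast
    field_simp
  have hh0 : h w₀ = 0 := by simp [hh, hexp0]
  have hU : IsOpen {w : ℂ | 1 + Complex.exp (α * w) ≠ 0} :=
    isOpen_ne_fun (by fun_prop) continuous_const
  have hUmem {w : ℂ} (hw : |w.im| ≤ Real.pi) : w ∈ {w : ℂ | 1 + Complex.exp (α * w) ≠ 0} := by
    refine one_add_cexp_ne_zero ?_
    simp only [Complex.mul_im, Complex.ofReal_re, Complex.ofReal_im, zero_mul, add_zero, abs_mul,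
      abs_of_pos h0]
    nlinarith [Real.pi_pos]
  have hw₀U : w₀ ∈ {w : ℂ | 1 + Complex.exp (α * w) ≠ 0} :=
    hUmem (by simp [hw₀, Real.pi_pos.le])
  have hfdiff : DifferentiableOn ℂ (dslope f w₀) {w : ℂ | 1 + Complex.exp (α * w) ≠ 0} := by
    rw [Complex.differentiableOn_dslope (hU.mem_nhds hw₀U)]
    intro w hw
    refine DifferentiableAt.differentiableWithinAt (DifferentiableAt.inv (by fun_prop) hw)
  have hhdiff : Differentiable ℂ (dslope h w₀) := by
    rw [← differentiableOn_univ, Complex.differentiableOn_dslope univ_mem]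
    exact (by fun_prop : Differentiable ℂ h).differentiableOn
  have hhne {w : ℂ} (hw : |w.im| ≤ Real.pi) : dslope h w₀ w ≠ 0 := by
    by_cases hne : w = w₀
    · rw [hne, dslope_same]
      have : HasDerivAt h (-(s * Complex.exp w₀)) w₀ :=
        ((Complex.hasDerivAt_exp w₀).const_mul (s : ℂ)).const_sub 1
      rw [this.deriv, hexp0]
      simp
    · rw [dslope_of_ne _ hne, slope_def_field, hh0, sub_zero]
      exact div_ne_zero (one_sub_mul_cexp_ne_zero hs hw hne) (sub_ne_zero.mpr hne)
  have hGdiff {w : ℂ} (hw : |w.im| ≤ Real.pi) : DifferentiableAt ℂ G w :=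
    ((hfdiff w (hUmem hw)).differentiableAt (hU.mem_nhds (hUmem hw))).div (hhdiff w) (hhne hw)
  have hGeq {w : ℂ} (hne : w ≠ w₀) : G w = (f w - f w₀) / h w := by
    simp only [hG]
    rw [dslope_of_ne _ hne, dslope_of_ne _ hne, slope_def_field, slope_def_field, hh0, sub_zero,
      div_div_div_cancel_right₀ (sub_ne_zero.mpr hne)]
  have hcont (x : ℝ) : ContinuousOn (fun y : ℝ => G (x + y * Complex.I))
      (Icc (-Real.pi) Real.pi) := by
    intro y hy
    have hd : DifferentiableAt ℂ G (x + y * Complex.I) := by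
      refine hGdiff ?_
      simpa [abs_le] using hy
    have hc : ContinuousAt (fun y : ℝ => (x + y * Complex.I : ℂ)) y := by fun_prop
    exact (ContinuousAt.comp (f := fun y : ℝ => (x + y * Complex.I : ℂ)) hd.continuousAt
      hc).continuousWithinAt
  have hscale {l : Filter ℝ} (hl : Tendsto (fun x => α * x) l l) :
      Tendsto (fun w : ℂ => (α : ℂ) * w) (comap Complex.re l) (comap Complex.re l) := by
    rw [tendsto_comap_iff]
    have := hl.comp (tendsto_comap (f := Complex.re) (x := l))
    refine this.congr fun w => ?_
    simp
  have hbot : Tendsto G (comap Complex.re atBot) (𝓝 (1 - f w₀)) := by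
    have hfl : Tendsto f (comap Complex.re atBot) (𝓝 1) := by
      have := (Complex.tendsto_exp_comap_re_atBot.comp
        (hscale (tendsto_id.const_mul_atBot h0))).const_add 1
      simpa [hf, Function.comp_def] using this.inv₀ (by simp)
    have hhl : Tendsto h (comap Complex.re atBot) (𝓝 1) := by
      simpa [hh] using (Complex.tendsto_exp_comap_re_atBot.const_mul (s : ℂ)).const_sub 1
    have := (hfl.sub_const (f w₀)).div hhl one_ne_zero
    rw [div_one] at this
    refine this.congr' ?_
    have hev : ∀ᶠ w in comap Complex.re atBot, w.re < -Real.log s :=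
      tendsto_comap.eventually (eventually_lt_atBot _)
    filter_upwards [hev] with w hw
    refine (hGeq ?_).symm
    rintro rfl
    simp [hw₀] at hw
  have htop : Tendsto G (comap Complex.re atTop) (𝓝 0) := by
    have hfl : Tendsto f (comap Complex.re atTop) (𝓝 0) :=
      tendsto_inv₀_cobounded.comp ((tendsto_const_add_cobounded (1 : ℂ)).comp
        (Complex.tendsto_exp_comap_re_atTop.comp (hscale (tendsto_id.const_mul_atTop h0))))
    have hhl : Tendsto (fun w => (h w)⁻¹) (comap Complex.re atTop) (𝓝 0) := by
      have : Tendsto (fun w => (Complex.exp w)⁻¹) (comap Complex.re atTop) (𝓝 0) :=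
        tendsto_inv₀_cobounded.comp Complex.tendsto_exp_comap_re_atTop
      have h2 := this.div (this.sub_const (s : ℂ)) (by simpa using hs')
      rw [zero_div] at h2
      refine h2.congr fun w => ?_
      have he := Complex.exp_ne_zero w
      have h3 : (Complex.exp w)⁻¹ - s = (Complex.exp w)⁻¹ * h w := by
        simp only [hh]
        field_simp
      change (Complex.exp w)⁻¹ / ((Complex.exp w)⁻¹ - s) = (h w)⁻¹
      rw [h3, div_mul_cancel_left₀ (inv_ne_zero he)]
    have := (hfl.sub_const (f w₀)).mul hhl
    rw [mul_zero] at this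
    refine this.congr' ?_
    have hev : ∀ᶠ w in comap Complex.re atTop, -Real.log s < w.re :=
      tendsto_comap.eventually (eventually_gt_atTop _)
    filter_upwards [hev] with w hw
    rw [hGeq, div_eq_mul_inv]
    rintro rfl
    simp [hw₀] at hw
  have hleft := (tendsto_intervalIntegral_vertical hcont Real.pi_pos.le hbot).comp
    tendsto_neg_atTop_atBot
  have hright := tendsto_intervalIntegral_vertical hcont Real.pi_pos.le htop
  have hrect (R : ℝ) : ((∫ x in (-R)..R, Real.exp x * rhoDensity α (Real.exp x) /
      (1 + s * Real.exp x) : ℝ) : ℂ) = (2 * Real.pi : ℂ)⁻¹ *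
      ((∫ y in (-Real.pi)..Real.pi, G ((-R : ℝ) + y * Complex.I)) -
        ∫ y in (-Real.pi)..Real.pi, G (R + y * Complex.I)) := by
    have hc := Complex.integral_boundary_rect_eq_zero_of_differentiableOn G
      ⟨-R, -Real.pi⟩ ⟨R, Real.pi⟩ fun w hw => by
        refine (hGdiff ?_).differentiableWithinAt
        have := hw.2
        simp only [mem_preimage] at this
        rw [uIcc_of_le (by linarith [Real.pi_pos])] at this
        exact abs_le.mpr this
    simp only [smul_eq_mul] at hc
    have hhor (σ : ℝ) (hσ : |σ| = Real.pi) :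
        IntervalIntegrable (fun x : ℝ => G (x + σ * Complex.I)) volume (-R) R := by
      refine Continuous.intervalIntegrable ?_ _ _
      rw [continuous_iff_continuousAt]
      intro x
      have hd : DifferentiableAt ℂ G (x + σ * Complex.I) := by
        refine hGdiff ?_
        simp [hσ]
      have hc : ContinuousAt (fun x : ℝ => (x + σ * Complex.I : ℂ)) x := by fun_prop
      exact ContinuousAt.comp (f := fun x : ℝ => (x + σ * Complex.I : ℂ)) hd.continuousAt hc
    rw [← intervalIntegral.integral_sub (hhor _ (by simp [Real.pi_pos.le]))
      (hhor _ (by simp [Real.pi_pos.le]))] at hc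
    have hval (x : ℝ) : G (x + (-Real.pi : ℝ) * Complex.I) - G (x + (Real.pi : ℝ) * Complex.I) =
        2 * Real.pi * Complex.I * ((Real.exp x * rhoDensity α (Real.exp x) /
          (1 + s * Real.exp x) : ℝ) : ℂ) := by
      have hne (σ : ℝ) (hσ : σ ≠ 0) : (x + σ * Complex.I : ℂ) ≠ w₀ := by
        intro hcon
        have := congrArg Complex.im hcon
        simp [hw₀] at this
        exact hσ this
      have he (σ : ℝ) (hσ : Complex.exp (σ * Complex.I) = -1) :
          h (x + σ * Complex.I) = ((1 + s * Real.exp x : ℝ) : ℂ) := by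
        simp only [hh]
        rw [Complex.exp_add, hσ]
        push_cast
        ring
      rw [hGeq (hne _ (by simp [Real.pi_ne_zero])), hGeq (hne _ Real.pi_ne_zero),
        he _ (by push_cast; rw [neg_mul, Complex.exp_neg, Complex.exp_pi_mul_I]; norm_num),
        he _ Complex.exp_pi_mul_I, ← sub_div, sub_sub_sub_cancel_right, Complex.ofReal_div,
        ← mul_div_assoc, ← ofReal_exp_mul_rhoDensity h0 h1 x]
    simp_rw [hval] at hc
    rw [intervalIntegral.integral_const_mul, intervalIntegral.integral_ofReal] at hc
    have hpi : (Real.pi : ℂ) ≠ 0 := by exact_mod_cast Real.pi_ne_zero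
    have hI := Complex.I_ne_zero
    rw [eq_inv_mul_iff_mul_eq₀ (by simp [hpi])]
    refine mul_left_cancel₀ hI ?_
    linear_combination hc
  have hlim : Tendsto (fun R : ℝ => ((∫ x in (-R)..R, Real.exp x * rhoDensity α (Real.exp x) /
      (1 + s * Real.exp x) : ℝ) : ℂ)) atTop
      (𝓝 ((2 * Real.pi : ℂ)⁻¹ * (2 * Real.pi * (1 - f w₀) - 2 * Real.pi * 0))) := by
    simp_rw [hrect]
    exact (hleft.sub hright).const_mul _
  have hfin : ((2 * Real.pi : ℂ)⁻¹ * (2 * Real.pi * (1 - f w₀) - 2 * Real.pi * 0)) =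
      ((1 / (1 + s ^ α) : ℝ) : ℂ) := by
    have hpi : (Real.pi : ℂ) ≠ 0 := by exact_mod_cast Real.pi_ne_zero
    have hfw : f w₀ = ((s ^ α / (1 + s ^ α) : ℝ) : ℂ) := by
      have : Complex.exp (α * w₀) = (((s ^ α)⁻¹ : ℝ) : ℂ) := by
        rw [← Real.rpow_neg hs.le, Real.rpow_def_of_pos hs, Complex.ofReal_exp, hw₀]
        push_cast
        ring_nf
      simp only [hf]
      rw [this, ← Complex.ofReal_one, ← Complex.ofReal_add, ← Complex.ofReal_inv]
      congr 1
      have := Real.rpow_pos_of_pos hs α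
      field_simp
      ring
    rw [hfw, mul_zero, sub_zero, inv_mul_cancel_left₀ (by simp [hpi]), ← Complex.ofReal_one,
      ← Complex.ofReal_sub]
    congr 1
    have := Real.rpow_pos_of_pos hs α
    field_simp
    ring
  rw [hfin] at hlim
  exact (Complex.continuous_re.tendsto _).comp hlim

theorem lintegral_Ioi_eq_lintegral_comp_exp (g : ℝ → ℝ≥0∞) :
    ∫⁻ y in Ioi (0 : ℝ), g y = ∫⁻ x, ENNReal.ofReal (Real.exp x) * g (Real.exp x) := by
  have := lintegral_image_eq_lintegral_abs_deriv_mul MeasurableSet.univ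
    (fun x _ => (Real.hasDerivAt_exp x).hasDerivWithinAt) Real.exp_injective.injOn g
  simpa [image_univ, Real.range_exp, abs_of_pos (Real.exp_pos _)] using this

theorem measurable_rhoDensity (α : ℝ) : Measurable (rhoDensity α) := by
  unfold rhoDensity
  fun_prop

theorem lintegral_rhoLaw (α : ℝ) {g : ℝ → ℝ≥0∞} (hg : Measurable g) :
    ∫⁻ y, g y ∂(rhoLaw α) = ∫⁻ y in Ioi 0, ENNReal.ofReal (rhoDensity α y) * g y := by
  rw [rhoLaw, lintegral_withDensity_eq_lintegral_mul _ (measurable_rhoDensity α).ennreal_ofReal hg]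
  rfl

/-- The Stieltjes transform of `ϱ_α`. -/
theorem lintegral_rhoLaw_inv {α s : ℝ} (h0 : 0 < α) (h1 : α < 1) (hs : 0 < s) :
    ∫⁻ y, ENNReal.ofReal (1 / (1 + s * y)) ∂(rhoLaw α) = ENNReal.ofReal (1 / (1 + s ^ α)) := by
  set q : ℝ → ℝ := fun x => Real.exp x * rhoDensity α (Real.exp x) / (1 + s * Real.exp x) with hq
  have hqc : Continuous q := (continuous_exp_mul_rhoDensity h0 h1).div (by fun_prop)
    fun x => by positivity
  have hq0 (x : ℝ) : 0 ≤ q x :=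
    div_nonneg (mul_nonneg (Real.exp_pos x).le (rhoDensity_nonneg h0 h1 (Real.exp_pos x)))
      (by positivity)
  have ht : Tendsto (fun R : ℝ => ∫ x in (-R)..R, q x) atTop (𝓝 (1 / (1 + s ^ α))) :=
    tendsto_intervalIntegral_exp_mul_rhoDensity h0 h1 hs
  have hint : Integrable q := by
    refine integrable_of_intervalIntegral_norm_tendsto (1 / (1 + s ^ α))
      (fun R => hqc.integrableOn_Icc.mono_set Ioc_subset_Icc_self) tendsto_neg_atTop_atBot
      tendsto_id (ht.congr fun R => ?_)
    simp [abs_of_nonneg (hq0 _)]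
  have hval : ∫ x, q x = 1 / (1 + s ^ α) :=
    tendsto_nhds_unique (intervalIntegral_tendsto_integral hint tendsto_neg_atTop_atBot tendsto_id)
      ht
  rw [lintegral_rhoLaw α (by fun_prop), lintegral_Ioi_eq_lintegral_comp_exp, ← hval,
    ofReal_integral_eq_lintegral_ofReal hint (ae_of_all _ hq0)]
  congr with x
  have := rhoDensity_nonneg h0 h1 (Real.exp_pos x)
  rw [← ENNReal.ofReal_mul this, ← ENNReal.ofReal_mul (Real.exp_pos x).le]
  simp only [hq]
  ring_nf

theorem rhoLaw_ae_pos (α : ℝ) : ∀ᵐ y ∂(rhoLaw α), 0 < y :=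
  (withDensity_absolutelyContinuous _ _).ae_le (ae_restrict_mem measurableSet_Ioi)

theorem isProbabilityMeasure_rhoLaw {α : ℝ} (h0 : 0 < α) (h1 : α < 1) :
    IsProbabilityMeasure (rhoLaw α) := by
  have hlim : Tendsto (fun n : ℕ => 1 / ((n : ℝ) + 1)) atTop (𝓝 0) :=
    tendsto_one_div_add_atTop_nhds_zero_nat
  have h2 : Tendsto (fun n : ℕ => ∫⁻ y, ENNReal.ofReal (1 / (1 + 1 / ((n : ℝ) + 1) * y)) ∂(rhoLaw α))
      atTop (𝓝 (∫⁻ _, 1 ∂(rhoLaw α))) := by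
    refine lintegral_tendsto_of_tendsto_of_monotone (fun n => by fun_prop) ?_ ?_
    · filter_upwards [rhoLaw_ae_pos α] with y hy n m hnm
      refine ENNReal.ofReal_le_ofReal ?_
      gcongr
    · refine ae_of_all _ fun y => ?_
      have := ((hlim.mul_const y).const_add 1)
      rw [zero_mul, add_zero] at this
      have := ENNReal.tendsto_ofReal (this.inv₀ one_ne_zero)
      simpa only [inv_one, ENNReal.ofReal_one, one_div] using this
  have h3 : Tendsto (fun n : ℕ => ∫⁻ y, ENNReal.ofReal (1 / (1 + 1 / ((n : ℝ) + 1) * y)) ∂(rhoLaw α))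
      atTop (𝓝 1) := by
    have h4 (n : ℕ) := lintegral_rhoLaw_inv h0 h1 (s := 1 / ((n : ℝ) + 1)) (by positivity)
    simp_rw [h4]
    have h5 := (hlim.rpow_const (p := α) (Or.inr h0.le)).const_add 1
    rw [Real.zero_rpow h0.ne', add_zero] at h5
    simpa using ENNReal.tendsto_ofReal (h5.inv₀ one_ne_zero)
  have := tendsto_nhds_unique h2 h3
  exact ⟨by simpa using this⟩

theorem lintegral_rhoLaw_div {α s : ℝ} (h0 : 0 < α) (h1 : α < 1) (hs : 0 < s) :
    ∫⁻ y, ENNReal.ofReal (y / (1 + s * y)) ∂(rhoLaw α) =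
      ENNReal.ofReal (s ^ (α - 1) / (1 + s ^ α)) := by
  have := isProbabilityMeasure_rhoLaw h0 h1
  have hsα := Real.rpow_pos_of_pos hs α
  have hA := lintegral_rhoLaw_inv h0 h1 hs
  have hsum : ENNReal.ofReal s * ∫⁻ y, ENNReal.ofReal (y / (1 + s * y)) ∂(rhoLaw α) +
      ENNReal.ofReal (1 / (1 + s ^ α)) = ENNReal.ofReal s *
      ENNReal.ofReal (s ^ (α - 1) / (1 + s ^ α)) + ENNReal.ofReal (1 / (1 + s ^ α)) := by
    rw [← ENNReal.ofReal_mul hs.le, ← ENNReal.ofReal_add (by positivity) (by positivity), ← hA,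
      ← lintegral_const_mul _ (by fun_prop), ← lintegral_add_left (by fun_prop)]
    have hr : s * (s ^ (α - 1) / (1 + s ^ α)) + 1 / (1 + s ^ α) = 1 := by
      rw [Real.rpow_sub_one hs.ne']
      field_simp
      ring
    have hl : ∫⁻ y, (ENNReal.ofReal s * ENNReal.ofReal (y / (1 + s * y)) +
        ENNReal.ofReal (1 / (1 + s * y))) ∂(rhoLaw α) = ∫⁻ _, 1 ∂(rhoLaw α) := by
      refine lintegral_congr_ae ?_
      filter_upwards [rhoLaw_ae_pos α] with y hy
      rw [← ENNReal.ofReal_mul hs.le, ← ENNReal.ofReal_add (by positivity) (by positivity),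
        ← ENNReal.ofReal_one]
      congr 1
      field_simp
      ring
    rw [hl, hr]
    simp
  have hcancel := (ENNReal.add_left_inj ENNReal.ofReal_ne_top).mp hsum
  exact (ENNReal.mul_right_inj (by simpa using hs) ENNReal.ofReal_ne_top).mp hcancel

theorem setLIntegral_deriv_eq_ofReal_sub {f f' : ℝ → ℝ} {a b : ℝ} (hab : a ≤ b)
    (hcont : ContinuousOn f (Icc a b)) (hderiv : ∀ x ∈ Ioo a b, HasDerivAt f (f' x) x)
    (hpos : ∀ x ∈ Ioo a b, 0 ≤ f' x) :
    ∫⁻ x in Ioo a b, ENNReal.ofReal (f' x) = ENNReal.ofReal (f b - f a) := by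
  have hint := intervalIntegral.integrableOn_deriv_of_nonneg hcont hderiv hpos
  rw [← intervalIntegral.integral_eq_sub_of_hasDerivAt_of_le hab hcont hderiv
    ((intervalIntegrable_iff_integrableOn_Ioc_of_le hab).mpr hint),
    intervalIntegral.integral_of_le hab, integral_Ioc_eq_integral_Ioo,
    ofReal_integral_eq_lintegral_ofReal (hint.mono_set Ioo_subset_Ioc_self)]
  filter_upwards [ae_restrict_mem measurableSet_Ioo] with x hx using hpos x hx

theorem lintegral_rhoLaw_log {α l : ℝ} (h0 : 0 < α) (h1 : α < 1) (hl : 0 < l) :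
    ∫⁻ y, ENNReal.ofReal (Real.log (1 + l * y)) ∂(rhoLaw α) =
      ENNReal.ofReal (1 / α * Real.log (1 + l ^ α)) := by
  have := isProbabilityMeasure_rhoLaw h0 h1
  have hlog (y : ℝ) (hy : 0 < y) : ENNReal.ofReal (Real.log (1 + l * y)) =
      ∫⁻ s in Ioo 0 l, ENNReal.ofReal (y / (1 + s * y)) := by
    have hp (s : ℝ) (hs : 0 ≤ s) : 0 < 1 + s * y := by positivity
    have hd (s : ℝ) (hs : 0 ≤ s) :
        HasDerivAt (fun s => Real.log (1 + s * y)) (y / (1 + s * y)) s := by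
      have := (((hasDerivAt_id s).mul_const y).const_add 1).log (hp s hs).ne'
      simpa using this
    rw [setLIntegral_deriv_eq_ofReal_sub hl.le (f := fun s => Real.log (1 + s * y))
      (fun s hs => (hd s hs.1).continuousAt.continuousWithinAt) (fun s hs => hd s hs.1.le)
      fun s hs => div_nonneg hy.le (hp s hs.1.le).le]
    simp
  have hR : ∫⁻ s in Ioo 0 l, ENNReal.ofReal (s ^ (α - 1) / (1 + s ^ α)) =
      ENNReal.ofReal (1 / α * Real.log (1 + l ^ α)) := by
    have hp (s : ℝ) (hs : 0 ≤ s) : 0 < 1 + s ^ α := by positivity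
    rw [setLIntegral_deriv_eq_ofReal_sub hl.le (f := fun s => 1 / α * Real.log (1 + s ^ α))]
    · simp [Real.zero_rpow h0.ne']
    · refine ContinuousOn.mul continuousOn_const (ContinuousOn.log ?_ fun s hs => (hp s hs.1).ne')
      exact (continuous_const.add (Real.continuous_rpow_const h0.le)).continuousOn
    · intro s hs
      have := (((Real.hasDerivAt_rpow_const (p := α) (Or.inl hs.1.ne')).const_add 1).log
        (hp s hs.1.le).ne').const_mul (1 / α)
      refine this.congr_deriv ?_
      rw [mul_div_assoc, ← mul_assoc, one_div_mul_cancel h0.ne', one_mul]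
    · intro s hs
      exact div_nonneg (Real.rpow_nonneg hs.1.le _) (hp s hs.1.le).le
  rw [← hR]
  calc ∫⁻ y, ENNReal.ofReal (Real.log (1 + l * y)) ∂(rhoLaw α)
      = ∫⁻ y, (∫⁻ s in Ioo 0 l, ENNReal.ofReal (y / (1 + s * y))) ∂(rhoLaw α) := by
        refine lintegral_congr_ae ?_
        filter_upwards [rhoLaw_ae_pos α] with y hy using hlog y hy
    _ = ∫⁻ s in Ioo 0 l, ∫⁻ y, ENNReal.ofReal (y / (1 + s * y)) ∂(rhoLaw α) :=
        lintegral_lintegral_swap (Measurable.aemeasurable (by fun_prop))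
    _ = _ := setLIntegral_congr_fun measurableSet_Ioo fun s hs => lintegral_rhoLaw_div h0 h1 hs.1

theorem IsPositiveStableLaw.ae_nonneg {α : ℝ} {ν : Measure ℝ} (hν : IsPositiveStableLaw α ν) :
    ∀ᵐ x ∂ν, 0 ≤ x := by
  rw [ae_iff]
  simpa [Iio] using hν.nonneg

theorem IsPositiveStableLaw.lintegral_exp {α : ℝ} {ν : Measure ℝ} (hν : IsPositiveStableLaw α ν)
    {s : ℝ} (hs : 0 < s) :
    ∫⁻ x, ENNReal.ofReal (Real.exp (-(s * x))) ∂ν = ENNReal.ofReal (Real.exp (-(s ^ α))) := by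
  have := hν.isProbabilityMeasure
  rw [← hν.laplace s hs, ofReal_integral_eq_lintegral_ofReal]
  · refine Integrable.of_bound (by fun_prop) 1 ?_
    filter_upwards [hν.ae_nonneg] with x hx
    rw [Real.norm_of_nonneg (Real.exp_pos _).le, Real.exp_le_one_iff]
    nlinarith
  · exact ae_of_all _ fun x => (Real.exp_pos _).le

theorem IsPositiveStableLaw.ae_pos {α : ℝ} (hα : 0 < α) {ν : Measure ℝ}
    (hν : IsPositiveStableLaw α ν) : ∀ᵐ x ∂ν, 0 < x := by
  have hle (s : ℝ) (hs : 0 < s) : ν (Iic 0) ≤ ENNReal.ofReal (Real.exp (-(s ^ α))) := by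
    rw [← hν.lintegral_exp hs, ← lintegral_indicator_one measurableSet_Iic]
    refine lintegral_mono fun x => ?_
    by_cases hx : x ≤ 0
    · rw [indicator_of_mem (by simpa using hx), Pi.one_apply, ENNReal.one_le_ofReal,
        Real.one_le_exp_iff]
      nlinarith
    · rw [indicator_of_notMem (by simpa using hx)]
      exact zero_le
  have ht : Tendsto (fun s : ℝ => ENNReal.ofReal (Real.exp (-(s ^ α)))) atTop (𝓝 0) := by
    have := ENNReal.tendsto_ofReal (Real.tendsto_exp_neg_atTop_nhds_zero.comp
      (tendsto_rpow_atTop hα))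
    simpa using this
  have h0 : ν (Iic 0) ≤ 0 :=
    ge_of_tendsto ht ((eventually_gt_atTop 0).mono fun s hs => hle s hs)
  rw [ae_iff]
  simpa [Iic] using h0

/-- Negative moments of a positive random variable with Laplace transform `exp (-b s ^ α)`. -/
theorem lintegral_rpow_neg_of_laplace {Ω : Type*} [MeasurableSpace Ω] {P : Measure Ω} [SFinite P]
    {Z : Ω → ℝ} (hZ : Measurable Z) (hpos : ∀ᵐ ω ∂P, 0 < Z ω) {α b q : ℝ} (hα : 0 < α) (hb : 0 < b)
    (hq : 0 < q)
    (hlap : ∀ s : ℝ, 0 < s → ∫⁻ ω, ENNReal.ofReal (Real.exp (-(s * Z ω))) ∂P =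
      ENNReal.ofReal (Real.exp (-(b * s ^ α)))) :
    ∫⁻ ω, ENNReal.ofReal (Z ω ^ (-q)) ∂P =
      ENNReal.ofReal (b ^ (-q / α)) * ENNReal.ofReal (Real.Gamma (q / α) / (α * Real.Gamma q)) := by
  have hΓ := Real.Gamma_pos_of_pos hq
  have hΓ' := Real.Gamma_pos_of_pos (div_pos hq hα)
  have hmain : ENNReal.ofReal (Real.Gamma q) * ∫⁻ ω, ENNReal.ofReal (Z ω ^ (-q)) ∂P =
      ENNReal.ofReal (b ^ (-q / α) * (1 / α) * Real.Gamma (q / α)) := by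
    calc ENNReal.ofReal (Real.Gamma q) * ∫⁻ ω, ENNReal.ofReal (Z ω ^ (-q)) ∂P
        = ∫⁻ ω, (∫⁻ u in Ioi (0 : ℝ),
            ENNReal.ofReal (u ^ (q - 1) * Real.exp (-(Z ω * u)))) ∂P := by
          rw [← lintegral_const_mul _ (by fun_prop)]
          refine lintegral_congr_ae ?_
          filter_upwards [hpos] with ω hω
          rw [setLIntegral_rpow_mul_exp_neg_mul hq hω, ENNReal.ofReal_mul hΓ.le]
      _ = ∫⁻ u in Ioi (0 : ℝ), ∫⁻ ω,
            ENNReal.ofReal (u ^ (q - 1) * Real.exp (-(Z ω * u))) ∂P :=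
          lintegral_lintegral_swap (Measurable.aemeasurable (by fun_prop))
      _ = ∫⁻ u in Ioi (0 : ℝ), ENNReal.ofReal (u ^ (q - 1) * Real.exp (-(b * u ^ α))) := by
          refine setLIntegral_congr_fun measurableSet_Ioi fun u hu => ?_
          have hu : 0 < u := hu
          have h1 : 0 ≤ u ^ (q - 1) := by positivity
          simp_rw [ENNReal.ofReal_mul h1]
          rw [lintegral_const_mul _ (by fun_prop), ← hlap u hu]
          simp_rw [mul_comm]
      _ = _ := setLIntegral_rpow_mul_exp_neg_mul_rpow hα hq hb
  refine (ENNReal.mul_right_inj (by simpa using hΓ) ENNReal.ofReal_ne_top).mp ?_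
  rw [hmain, ← ENNReal.ofReal_mul (by positivity), ← ENNReal.ofReal_mul hΓ.le]
  congr 1
  field_simp

theorem IsPositiveStableLaw.lintegral_rpow_neg {α : ℝ} (hα : 0 < α) {ν : Measure ℝ}
    (hν : IsPositiveStableLaw α ν) {q : ℝ} (hq : 0 < q) :
    ∫⁻ x, ENNReal.ofReal (x ^ (-q)) ∂ν =
      ENNReal.ofReal (Real.Gamma (q / α) / (α * Real.Gamma q)) := by
  have := hν.isProbabilityMeasure
  have := lintegral_rpow_neg_of_laplace measurable_id (hν.ae_pos hα) hα one_pos hq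
    (fun s hs => by simpa using hν.lintegral_exp hs)
  simpa using this

theorem IsPositiveStableLaw.lintegral_add_mul_rpow_neg {α : ℝ} (hα : 0 < α) {ν : Measure ℝ}
    (hν : IsPositiveStableLaw α ν) {q l : ℝ} (hq : 0 < q) (hl : 0 < l) :
    ∫⁻ z, ENNReal.ofReal ((z.2 + l * z.1) ^ (-q)) ∂(ν.prod ν) =
      ENNReal.ofReal ((1 + l ^ α) ^ (-q / α)) * ∫⁻ x, ENNReal.ofReal (x ^ (-q)) ∂ν := by
  have := hν.isProbabilityMeasure
  rw [hν.lintegral_rpow_neg hα hq]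
  refine lintegral_rpow_neg_of_laplace (Z := fun z : ℝ × ℝ => z.2 + l * z.1) (by fun_prop) ?_ hα
    (by positivity) hq fun s hs => ?_
  · have h1 : ∀ᵐ z ∂(ν.prod ν), 0 < z.1 := Measure.quasiMeasurePreserving_fst.ae (hν.ae_pos hα)
    have h2 : ∀ᵐ z ∂(ν.prod ν), 0 < z.2 := Measure.quasiMeasurePreserving_snd.ae (hν.ae_pos hα)
    filter_upwards [h1, h2] with z h1 h2
    positivity
  · have hfac (z : ℝ × ℝ) : ENNReal.ofReal (Real.exp (-(s * (z.2 + l * z.1)))) =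
        ENNReal.ofReal (Real.exp (-(s * l * z.1))) * ENNReal.ofReal (Real.exp (-(s * z.2))) := by
      rw [← ENNReal.ofReal_mul (Real.exp_pos _).le, ← Real.exp_add]
      ring_nf
    simp_rw [hfac]
    rw [lintegral_prod_mul (f := fun x => ENNReal.ofReal (Real.exp (-(s * l * x))))
      (g := fun x => ENNReal.ofReal (Real.exp (-(s * x)))) (by fun_prop) (by fun_prop),
      hν.lintegral_exp hs, hν.lintegral_exp (mul_pos hs hl),
      ← ENNReal.ofReal_mul (Real.exp_pos _).le, ← Real.exp_add, Real.mul_rpow hs.le hl.le]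
    ring_nf

theorem lintegral_polynomialTilt (q : ℝ) (ν : Measure ℝ) {f : ℝ → ℝ≥0∞} (hf : Measurable f) :
    ∫⁻ t, f t ∂(polynomialTilt q ν) =
      (∫⁻ t, ENNReal.ofReal (t ^ (-q)) ∂ν)⁻¹ * ∫⁻ t, ENNReal.ofReal (t ^ (-q)) * f t ∂ν := by
  rw [polynomialTilt, lintegral_smul_measure,
    lintegral_withDensity_eq_lintegral_mul _ (by fun_prop) hf]
  rfl

theorem polynomialTilt_ae_pos (q : ℝ) {ν : Measure ℝ} (hν : ∀ᵐ x ∂ν, 0 < x) :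
    ∀ᵐ x ∂(polynomialTilt q ν), 0 < x :=
  ((Measure.smul_absolutelyContinuous).trans (withDensity_absolutelyContinuous _ _)).ae_le hν

theorem IsPositiveStableLaw.lintegral_rpow_neg_ne_zero {α : ℝ} (hα : 0 < α) {ν : Measure ℝ}
    (hν : IsPositiveStableLaw α ν) {q : ℝ} (hq : 0 < q) :
    ∫⁻ x, ENNReal.ofReal (x ^ (-q)) ∂ν ≠ 0 := by
  rw [hν.lintegral_rpow_neg hα hq]
  have h1 := Real.Gamma_pos_of_pos hq
  have h2 := Real.Gamma_pos_of_pos (div_pos hq hα)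
  simp only [ne_eq, ENNReal.ofReal_eq_zero, not_le]
  positivity

theorem IsPositiveStableLaw.lintegral_rpow_neg_ne_top {α : ℝ} (hα : 0 < α) {ν : Measure ℝ}
    (hν : IsPositiveStableLaw α ν) {q : ℝ} (hq : 0 < q) :
    ∫⁻ x, ENNReal.ofReal (x ^ (-q)) ∂ν ≠ ∞ := by
  rw [hν.lintegral_rpow_neg hα hq]
  exact ENNReal.ofReal_ne_top

theorem IsPositiveStableLaw.isProbabilityMeasure_polynomialTilt {α : ℝ} (hα : 0 < α)
    {ν : Measure ℝ} (hν : IsPositiveStableLaw α ν) {q : ℝ} (hq : 0 < q) :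
    IsProbabilityMeasure (polynomialTilt q ν) := by
  constructor
  rw [← lintegral_one, lintegral_polynomialTilt q ν measurable_const]
  simp only [mul_one]
  exact ENNReal.inv_mul_cancel (hν.lintegral_rpow_neg_ne_zero hα hq)
    (hν.lintegral_rpow_neg_ne_top hα hq)

theorem IsPositiveStableLaw.lintegral_polynomialTilt_rpow {α : ℝ} (hα : 0 < α)
    {ν : Measure ℝ} (hν : IsPositiveStableLaw α ν) {q p : ℝ} :
    ∫⁻ t, ENNReal.ofReal (t ^ (-p)) ∂(polynomialTilt q ν) =
      (∫⁻ t, ENNReal.ofReal (t ^ (-q)) ∂ν)⁻¹ * ∫⁻ t, ENNReal.ofReal (t ^ (-(q + p))) ∂ν := by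
  rw [lintegral_polynomialTilt q ν (by fun_prop)]
  congr 1
  refine lintegral_congr_ae ?_
  filter_upwards [hν.ae_pos hα] with x hx
  rw [← ENNReal.ofReal_mul (by positivity), ← Real.rpow_add hx, neg_add]

/-- The generalized Stieltjes transform of `S_α / T_{α,q}`. -/
theorem IsPositiveStableLaw.lintegral_ratio {α : ℝ} (hα : 0 < α) {ν : Measure ℝ}
    (hν : IsPositiveStableLaw α ν) {q l : ℝ} (hq : 0 < q) (hl : 0 < l) :
    ∫⁻ z, ENNReal.ofReal ((1 + l * (z.1 / z.2)) ^ (-q)) ∂(ν.prod (polynomialTilt q ν)) =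
      ENNReal.ofReal ((1 + l ^ α) ^ (-q / α)) := by
  have := hν.isProbabilityMeasure
  have := hν.isProbabilityMeasure_polynomialTilt hα hq
  have h0 := hν.lintegral_rpow_neg_ne_zero hα hq
  have hT := hν.lintegral_rpow_neg_ne_top hα hq
  have h := hν.lintegral_add_mul_rpow_neg hα hq hl
  rw [lintegral_prod _ (by fun_prop)] at h ⊢
  have hin : ∀ᵐ x ∂ν, ∫⁻ t, ENNReal.ofReal ((1 + l * (x / t)) ^ (-q)) ∂(polynomialTilt q ν) =
      (∫⁻ t, ENNReal.ofReal (t ^ (-q)) ∂ν)⁻¹ *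
        ∫⁻ t, ENNReal.ofReal ((t + l * x) ^ (-q)) ∂ν := by
    filter_upwards [hν.ae_pos hα] with x hx
    rw [lintegral_polynomialTilt q ν (by fun_prop)]
    congr 1
    refine lintegral_congr_ae ?_
    filter_upwards [hν.ae_pos hα] with t ht
    rw [← ENNReal.ofReal_mul (by positivity), ← Real.mul_rpow ht.le (by positivity)]
    congr 2
    field_simp
  rw [lintegral_congr_ae hin, lintegral_const_mul _ (by fun_prop), h, mul_left_comm,
    ENNReal.inv_mul_cancel h0 hT, mul_one]

theorem setLIntegral_rpow_mul_one_add_rpow_neg {p q : ℝ} (hp : 0 < p) (hpq : p < q) :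
    ENNReal.ofReal (Real.Gamma q) *
      ∫⁻ u in Ioi (0 : ℝ), ENNReal.ofReal (u ^ (p - 1)) * ENNReal.ofReal ((1 + u) ^ (-q)) =
      ENNReal.ofReal (Real.Gamma p * Real.Gamma (q - p)) := by
  have hq : 0 < q := hp.trans hpq
  have hΓ := Real.Gamma_pos_of_pos hq
  have hΓp := Real.Gamma_pos_of_pos hp
  calc ENNReal.ofReal (Real.Gamma q) *
      ∫⁻ u in Ioi (0 : ℝ), ENNReal.ofReal (u ^ (p - 1)) * ENNReal.ofReal ((1 + u) ^ (-q))
      = ∫⁻ u in Ioi (0 : ℝ), ∫⁻ v in Ioi (0 : ℝ), ENNReal.ofReal (u ^ (p - 1)) *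
          ENNReal.ofReal (v ^ (q - 1) * Real.exp (-((1 + u) * v))) := by
        rw [← lintegral_const_mul _ (by fun_prop)]
        refine setLIntegral_congr_fun measurableSet_Ioi fun u hu => ?_
        have hu : 0 < u := hu
        rw [lintegral_const_mul _ (by fun_prop), setLIntegral_rpow_mul_exp_neg_mul hq
          (by positivity), mul_left_comm, ENNReal.ofReal_mul hΓ.le]
    _ = ∫⁻ v in Ioi (0 : ℝ), ∫⁻ u in Ioi (0 : ℝ), ENNReal.ofReal (u ^ (p - 1)) *
          ENNReal.ofReal (v ^ (q - 1) * Real.exp (-((1 + u) * v))) :=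
        lintegral_lintegral_swap (Measurable.aemeasurable (by fun_prop))
    _ = ∫⁻ v in Ioi (0 : ℝ), ENNReal.ofReal (Real.Gamma p) *
          ENNReal.ofReal (v ^ (q - p - 1) * Real.exp (-(1 * v))) := by
        refine setLIntegral_congr_fun measurableSet_Ioi fun v hv => ?_
        have hv : 0 < v := hv
        have h1 : ∀ u ∈ Ioi (0 : ℝ), ENNReal.ofReal (u ^ (p - 1)) *
            ENNReal.ofReal (v ^ (q - 1) * Real.exp (-((1 + u) * v))) =
            ENNReal.ofReal (v ^ (q - 1) * Real.exp (-(1 * v))) *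
              ENNReal.ofReal (u ^ (p - 1) * Real.exp (-(v * u))) := by
          intro u hu
          have hu : 0 < u := hu
          rw [← ENNReal.ofReal_mul (by positivity), ← ENNReal.ofReal_mul (by positivity),
            show -((1 + u) * v) = -(1 * v) + -(v * u) by ring, Real.exp_add]
          ring_nf
        rw [setLIntegral_congr_fun measurableSet_Ioi h1, lintegral_const_mul _ (by fun_prop),
          setLIntegral_rpow_mul_exp_neg_mul hp hv, ← ENNReal.ofReal_mul (by positivity),
          ← ENNReal.ofReal_mul (by positivity), show q - p - 1 = (q - 1) + -p by ring,
          Real.rpow_add hv]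
        ring_nf
    _ = _ := by
        rw [lintegral_const_mul _ (by fun_prop),
          setLIntegral_rpow_mul_exp_neg_mul (by linarith) one_pos, Real.one_rpow, mul_one,
          ENNReal.ofReal_mul hΓp.le]

/-- A finite measure on `(0, ∞)` with finite negative moments of orders less than `q` is
determined by its generalized Stieltjes transform of order `q`. -/
theorem ext_of_generalizedStieltjes {μ ν : Measure ℝ} [IsFiniteMeasure μ] [IsFiniteMeasure ν]
    (hμ : ∀ᵐ x ∂μ, 0 < x) (hν : ∀ᵐ x ∂ν, 0 < x) {q : ℝ} (hq : 0 < q)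
    (h : ∀ l : ℝ, 0 < l → ∫⁻ x, ENNReal.ofReal ((1 + l * x) ^ (-q)) ∂μ =
      ∫⁻ x, ENNReal.ofReal ((1 + l * x) ^ (-q)) ∂ν)
    (hfin : ∀ p ∈ Ioo 0 q, ∫⁻ x, ENNReal.ofReal (x ^ (-p)) ∂ν ≠ ∞) : μ = ν := by
  have key (κ : Measure ℝ) [IsFiniteMeasure κ] (hκ : ∀ᵐ x ∂κ, 0 < x) (p : ℝ) :
      ∫⁻ l in Ioi (0 : ℝ), ENNReal.ofReal (l ^ (p - 1)) *
        (∫⁻ x, ENNReal.ofReal ((1 + l * x) ^ (-q)) ∂κ) =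
      (∫⁻ u in Ioi (0 : ℝ), ENNReal.ofReal (u ^ (p - 1)) * ENNReal.ofReal ((1 + u) ^ (-q))) *
        ∫⁻ x, ENNReal.ofReal (x ^ (-p)) ∂κ := by
    rw [← lintegral_const_mul _ (by fun_prop)]
    calc ∫⁻ l in Ioi (0 : ℝ), ENNReal.ofReal (l ^ (p - 1)) *
          (∫⁻ x, ENNReal.ofReal ((1 + l * x) ^ (-q)) ∂κ)
        = ∫⁻ l in Ioi (0 : ℝ), ∫⁻ x, ENNReal.ofReal (l ^ (p - 1)) *
            ENNReal.ofReal ((1 + l * x) ^ (-q)) ∂κ := by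
          refine lintegral_congr fun l => ?_
          rw [lintegral_const_mul _ (by fun_prop)]
      _ = ∫⁻ x, (∫⁻ l in Ioi (0 : ℝ), ENNReal.ofReal (l ^ (p - 1)) *
            ENNReal.ofReal ((1 + l * x) ^ (-q))) ∂κ :=
          lintegral_lintegral_swap (Measurable.aemeasurable (by fun_prop))
      _ = _ := by
          refine lintegral_congr_ae ?_
          filter_upwards [hκ] with x hx
          rw [setLIntegral_Ioi_eq_mul_lintegral_comp_mul _ (inv_pos.mpr hx),
            ← lintegral_const_mul _ (by fun_prop), ← lintegral_mul_const _ (by fun_prop)]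
          refine setLIntegral_congr_fun measurableSet_Ioi fun u hu => ?_
          have hu : 0 < u := hu
          have h1 : x⁻¹ * (x⁻¹ * u) ^ (p - 1) = u ^ (p - 1) * x ^ (-p) := by
            rw [Real.mul_rpow (by positivity) hu.le, Real.inv_rpow hx.le, Real.rpow_sub_one hx.ne',
              Real.rpow_neg hx.le]
            field_simp
          have h2 : x⁻¹ * u * x = u := by field_simp
          rw [h2, ← mul_assoc, ← ENNReal.ofReal_mul (by positivity), h1,
            ENNReal.ofReal_mul (by positivity), mul_right_comm]
  have hmom (p : ℝ) (hp : p ∈ Ioo 0 q) :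
      ∫⁻ x, ENNReal.ofReal (x ^ (-p)) ∂μ = ∫⁻ x, ENNReal.ofReal (x ^ (-p)) ∂ν := by
    have hc := setLIntegral_rpow_mul_one_add_rpow_neg hp.1 hp.2
    set c := ∫⁻ u in Ioi (0 : ℝ), ENNReal.ofReal (u ^ (p - 1)) * ENNReal.ofReal ((1 + u) ^ (-q))
    have hΓ := Real.Gamma_pos_of_pos hq
    have h1 := mul_pos (Real.Gamma_pos_of_pos hp.1) (Real.Gamma_pos_of_pos (sub_pos.mpr hp.2))
    have hc0 : c ≠ 0 := by
      rintro h0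
      rw [h0, mul_zero] at hc
      exact absurd (ENNReal.ofReal_eq_zero.mp hc.symm) (not_le.mpr h1)
    have hct : c ≠ ∞ := by
      rintro h0
      rw [h0, ENNReal.mul_top (by simpa using hΓ)] at hc
      exact ENNReal.ofReal_ne_top hc.symm
    refine (ENNReal.mul_right_inj hc0 hct).mp ?_
    rw [← key μ hμ p, ← key ν hν p]
    refine setLIntegral_congr_fun measurableSet_Ioi fun l hl => ?_
    rw [h l hl]
  refine ext_of_mellin_eqOn_Ioo hμ hν (neg_lt_zero.mpr hq) (fun p hp => ?_) fun p hp => ?_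
  · simpa using hmom (-p) ⟨by linarith [hp.2], by linarith [hp.1]⟩
  · have h2 : -p ∈ Ioo 0 q := ⟨by linarith [hp.2], by linarith [hp.1]⟩
    have := hmom (-p) h2 ▸ hfin (-p) h2
    simpa using this

theorem lintegral_dirichletDistribution_rpow {n : ℕ} {a b : Fin n → ℝ} (ha : ∀ i, 0 ≤ a i)
    (hb : ∀ i, 0 < b i) (hsum : 0 < ∑ i, a i) :
    ∫⁻ v, ENNReal.ofReal ((∑ i, b i * v i) ^ (-∑ i, a i)) ∂(dirichletDistribution a) =
      ENNReal.ofReal (∏ i, b i ^ (-a i)) := by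
  rw [← lintegral_pi_gammaLaw_ratio ha hb hsum, dirichletDistribution,
    lintegral_map (by fun_prop) (by fun_prop)]
  simp_rw [Finset.sum_div, mul_div_assoc]

theorem MeasureTheory.SimpleFunc.lintegral_comp_eq_sum {E : Type*} [MeasurableSpace E] (φ : SimpleFunc E ℝ≥0)
    (g : ℝ≥0 → ℝ≥0∞) (μ : Measure E) :
    ∫⁻ x, g (φ x) ∂μ = ∑ c : φ.range, g c * μ (φ ⁻¹' {(c : ℝ≥0)}) := by
  rw [show ∫⁻ x, g (φ x) ∂μ = ∫⁻ x, φ.map g x ∂μ from rfl, SimpleFunc.lintegral_eq_lintegral,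
    SimpleFunc.map_lintegral, ← Finset.sum_coe_sort]

theorem IsDirichletProcess.lintegral_simpleFunc {Ω E : Type*} [MeasurableSpace Ω]
    [MeasurableSpace E] {τ : ℝ} (hτ : 0 < τ) {H : Measure E} [IsProbabilityMeasure H]
    {D : Kernel Ω E} {P : Measure Ω} (hD : IsDirichletProcess τ H D P) (φ : SimpleFunc E ℝ≥0) :
    ∫⁻ ω, (1 + ∫⁻ x, φ x ∂(D ω)) ^ (-τ) ∂P = ENNReal.ofReal (Real.exp
      (-(τ * (∫⁻ x, ENNReal.ofReal (Real.log (1 + φ x)) ∂H).toReal))) := by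
  obtain ⟨hM, hD⟩ := hD
  set e := φ.range.equivFin with he
  set c : Fin φ.range.card → ℝ≥0 := fun i => (e.symm i : ℝ≥0) with hc
  set A : Fin φ.range.card → Set E := fun i => φ ⁻¹' {c i} with hA
  have hAm (i) : MeasurableSet (A i) := φ.measurableSet_fiber _
  have hsum (g : ℝ≥0 → ℝ≥0∞) (μ : Measure E) :
      ∫⁻ x, g (φ x) ∂μ = ∑ i, g (c i) * μ (A i) := by
    rw [SimpleFunc.lintegral_comp_eq_sum]
    exact (Equiv.sum_comp e.symm fun d : φ.range => g d * μ (φ ⁻¹' {(d : ℝ≥0)})).symm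
  have hdisj : Pairwise (fun i j => Disjoint (A i) (A j)) := by
    intro i j hij
    refine Disjoint.preimage _ ?_
    rw [disjoint_singleton]
    exact fun h => hij (e.symm.injective (Subtype.ext h))
  have hcover : (⋃ i, A i) = univ := by
    refine eq_univ_of_forall fun x => mem_iUnion.mpr ⟨e ⟨φ x, φ.mem_range_self x⟩, ?_⟩
    simp [hA, hc]
  have hone (μ : Measure E) [IsProbabilityMeasure μ] : ∑ i, μ.real (A i) = 1 := by
    have h1 := hsum (fun _ => 1) μ
    simp only [lintegral_const, measure_univ, one_mul] at h1
    simp only [measureReal_def]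
    rw [← ENNReal.toReal_sum fun i _ => measure_ne_top _ _, ← h1]
    simp
  have hlaw := hD _ A hAm hdisj hcover
  have ha0 (i) : 0 ≤ τ * H.real (A i) := by positivity
  have hasum : ∑ i, τ * H.real (A i) = τ := by rw [← Finset.mul_sum, hone, mul_one]
  have hb (i) : (0 : ℝ) < 1 + c i := by positivity
  have hmain := lintegral_dirichletDistribution_rpow ha0 hb (by rw [hasum]; exact hτ)
  have hmeas (b : Fin φ.range.card → ℝ) : Measurable fun v : Fin φ.range.card → ℝ =>
      ENNReal.ofReal ((∑ i, b i * v i) ^ (-τ)) := by fun_prop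
  rw [hasum, ← hlaw.lintegral_comp (hmeas _).aemeasurable] at hmain
  have hl : ∫⁻ ω, (1 + ∫⁻ x, φ x ∂(D ω)) ^ (-τ) ∂P =
      ∫⁻ ω, ENNReal.ofReal ((∑ i, (1 + (c i : ℝ)) * (D ω).real (A i)) ^ (-τ)) ∂P := by
    refine lintegral_congr fun ω => ?_
    have hX : ∫⁻ x, φ x ∂(D ω) = ENNReal.ofReal (∑ i, (c i : ℝ) * (D ω).real (A i)) := by
      rw [hsum (fun d => (d : ℝ≥0∞)), ENNReal.ofReal_sum_of_nonneg fun i _ => by positivity]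
      refine Finset.sum_congr rfl fun i _ => ?_
      rw [ENNReal.ofReal_mul (by positivity), ofReal_measureReal, ENNReal.ofReal_coe_nnreal]
    simp_rw [add_mul, one_mul]
    have h0 : 0 ≤ ∑ i, (c i : ℝ) * (D ω).real (A i) :=
      Finset.sum_nonneg fun i _ => by positivity
    rw [hX, Finset.sum_add_distrib, hone, ← ENNReal.ofReal_rpow_of_pos (by positivity),
      ENNReal.ofReal_add zero_le_one h0, ENNReal.ofReal_one]
  rw [hl, hmain, hsum (fun d => ENNReal.ofReal (Real.log (1 + d)))]
  congr 1
  have hlog (i) : 0 ≤ Real.log (1 + (c i : ℝ)) := Real.log_nonneg (by simp)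
  rw [ENNReal.toReal_sum fun i _ => ENNReal.mul_ne_top ENNReal.ofReal_ne_top (measure_ne_top _ _),
    Finset.mul_sum, ← Finset.sum_neg_distrib, Real.exp_sum]
  refine Finset.prod_congr rfl fun i _ => ?_
  rw [Real.rpow_def_of_pos (hb i), ENNReal.toReal_mul, ENNReal.toReal_ofReal (hlog i),
    ← measureReal_def]
  ring_nf

/-- The **Markov-Krein identity** for the mean `∫ f dD` of a Dirichlet process. -/
theorem IsDirichletProcess.lintegral_one_add_rpow {Ω E : Type*} [MeasurableSpace Ω]
    [MeasurableSpace E] {τ : ℝ} (hτ : 0 < τ) {H : Measure E} [IsProbabilityMeasure H]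
    {D : Kernel Ω E} {P : Measure Ω} [IsFiniteMeasure P] (hD : IsDirichletProcess τ H D P)
    {f : E → ℝ} (hf : Measurable f) (hf0 : ∀ x, 0 ≤ f x)
    (hfin : ∫⁻ x, ENNReal.ofReal (Real.log (1 + f x)) ∂H ≠ ∞) :
    ∫⁻ ω, (1 + ∫⁻ x, ENNReal.ofReal (f x) ∂(D ω)) ^ (-τ) ∂P = ENNReal.ofReal (Real.exp
      (-(τ * (∫⁻ x, ENNReal.ofReal (Real.log (1 + f x)) ∂H).toReal))) := by
  have hfm : Measurable fun x => ENNReal.ofReal (f x) := hf.ennreal_ofReal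
  set φ : ℕ → SimpleFunc E ℝ≥0 := fun n =>
    (SimpleFunc.eapprox (fun x => ENNReal.ofReal (f x)) n).map ENNReal.toNNReal with hφ
  have hφc (n : ℕ) (x : E) :
      (φ n x : ℝ≥0∞) = SimpleFunc.eapprox (fun x => ENNReal.ofReal (f x)) n x := by
    simp only [hφ, SimpleFunc.map_apply]
    exact ENNReal.coe_toNNReal (SimpleFunc.eapprox_lt_top _ n x).ne
  have hφmono (x : E) : Monotone fun n => (φ n x : ℝ≥0∞) := by
    intro n m hnm
    simp only [hφc]
    exact SimpleFunc.monotone_eapprox _ hnm x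
  have hφlim (x : E) : Tendsto (fun n => (φ n x : ℝ≥0∞)) atTop (𝓝 (ENNReal.ofReal (f x))) := by
    rw [← SimpleFunc.iSup_eapprox_apply hfm x]
    simp_rw [← hφc]
    exact tendsto_atTop_iSup (hφmono x)
  have hφreal (x : E) : Tendsto (fun n => (φ n x : ℝ)) atTop (𝓝 (f x)) := by
    have := (ENNReal.tendsto_toReal ENNReal.ofReal_ne_top).comp (hφlim x)
    rw [ENNReal.toReal_ofReal (hf0 x)] at this
    exact this
  have hlhs : Tendsto (fun n => ∫⁻ ω, (1 + ∫⁻ x, φ n x ∂(D ω)) ^ (-τ) ∂P) atTop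
      (𝓝 (∫⁻ ω, (1 + ∫⁻ x, ENNReal.ofReal (f x) ∂(D ω)) ^ (-τ) ∂P)) := by
    refine tendsto_lintegral_of_dominated_convergence (fun _ => 1) (fun n => ?_) (fun n => ?_)
      (by simp) ?_
    · have : Measurable fun ω => ∫⁻ x, φ n x ∂(D ω) :=
        Measurable.lintegral_kernel (φ n).measurable.coe_nnreal_ennreal
      fun_prop
    · exact ae_of_all _ fun ω => ENNReal.rpow_le_one_of_one_le_of_neg le_self_add (by linarith)
    · refine ae_of_all _ fun ω => ?_
      refine (ENNReal.continuous_rpow_const.tendsto _).comp (Tendsto.const_add 1 ?_)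
      exact lintegral_tendsto_of_tendsto_of_monotone
        (fun n => (φ n).measurable.coe_nnreal_ennreal.aemeasurable)
        (ae_of_all _ hφmono) (ae_of_all _ hφlim)
  have hrhs : Tendsto (fun n => ENNReal.ofReal (Real.exp
      (-(τ * (∫⁻ x, ENNReal.ofReal (Real.log (1 + φ n x)) ∂H).toReal)))) atTop
      (𝓝 (ENNReal.ofReal (Real.exp
      (-(τ * (∫⁻ x, ENNReal.ofReal (Real.log (1 + f x)) ∂H).toReal))))) := by
    refine ENNReal.tendsto_ofReal ((Real.continuous_exp.tendsto _).comp
      (Tendsto.neg (Tendsto.const_mul τ ((ENNReal.tendsto_toReal hfin).comp ?_))))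
    refine lintegral_tendsto_of_tendsto_of_monotone (fun n => ?_) (ae_of_all _ fun x n m hnm => ?_)
      (ae_of_all _ fun x => ?_)
    · have := (φ n).measurable
      fun_prop
    · have : φ n x ≤ φ m x := ENNReal.coe_le_coe.mp (hφmono x hnm)
      refine ENNReal.ofReal_le_ofReal (Real.log_le_log (by positivity) ?_)
      gcongr
    · have hne : 1 + f x ≠ 0 := by linarith [hf0 x]
      exact ENNReal.tendsto_ofReal (((hφreal x).const_add 1).log hne)
  exact tendsto_nhds_unique (hlhs.congr fun n => hD.lintegral_simpleFunc hτ (φ n)) hrhs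

theorem IsDirichletProcess.ae_measure_Iio_eq_zero {Ω : Type*} [MeasurableSpace Ω]
    {τ : ℝ} (hτ : 0 < τ) {H : Measure ℝ} [IsProbabilityMeasure H] {D : Kernel Ω ℝ} {P : Measure Ω}
    (hD : IsDirichletProcess τ H D P) (hH : H (Iio 0) = 0) : ∀ᵐ ω ∂P, D ω (Iio 0) = 0 := by
  obtain ⟨hM, hD⟩ := hD
  set A : Fin 2 → Set ℝ := ![Iio 0, Ici 0] with hA
  have hlaw := hD 2 A (by
      intro i
      fin_cases i
      · exact measurableSet_Iio
      · exact measurableSet_Ici) (by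
      intro i j hij
      have h1 : Disjoint (Iio (0 : ℝ)) (Ici 0) := by
        rw [← compl_Iio]
        exact disjoint_compl_right
      fin_cases i <;> fin_cases j
      · exact absurd rfl hij
      · exact h1
      · exact h1.symm
      · exact absurd rfl hij) (by
      refine eq_univ_of_forall fun x => mem_iUnion.mpr ?_
      rcases lt_or_ge x 0 with h | h
      · exact ⟨0, h⟩
      · exact ⟨1, h⟩)
  have ha (i) : 0 ≤ τ * H.real (A i) := by positivity
  have := fun i => isProbabilityMeasure_gammaLaw (ha i)
  have hdir : ∀ᵐ v ∂(dirichletDistribution fun i => τ * H.real (A i)), v 0 = 0 := by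
    rw [dirichletDistribution, ae_map_iff (by fun_prop)
      (measurableSet_eq_fun (by fun_prop) (by fun_prop))]
    have h0 : ∀ᵐ g ∂(Measure.pi fun i => gammaLaw (τ * H.real (A i))), g 0 = 0 := by
      refine (measurePreserving_eval (fun i => gammaLaw (τ * H.real (A i))) 0
        ).quasiMeasurePreserving.ae (p := fun x => x = 0) ?_
      have : τ * H.real (A 0) = 0 := by simp [hA, measureReal_def, hH]
      rw [gammaLaw, if_pos this, ae_dirac_eq]
      rfl
    filter_upwards [h0] with g hg
    rw [hg, zero_div]
  have h2 := (hlaw.ae_iff (p := fun v => v 0 = 0) (by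
    exact measurableSet_setOfPred.mp (measurableSet_eq_fun (by fun_prop) (by fun_prop)))).mpr hdir
  filter_upwards [h2] with ω hω
  exact (measureReal_eq_zero_iff (measure_ne_top _ _)).mp hω

theorem IsDirichletProcess.meanFunctional_rhoLaw {Ω : Type*} [MeasurableSpace Ω]
    {τ α : ℝ} (hτ : 0 < τ) (h0 : 0 < α) (h1 : α < 1) {D : Kernel Ω ℝ} {P : Measure Ω}
    [IsProbabilityMeasure P] (hD : IsDirichletProcess τ (rhoLaw α) D P) :
    (∀ᵐ ω ∂P, Integrable (fun x : ℝ => x) (D ω)) ∧ (∀ᵐ ω ∂P, 0 < meanFunctional D ω) ∧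
    ∀ l : ℝ, 0 < l → ∫⁻ ω, ENNReal.ofReal ((1 + l * meanFunctional D ω) ^ (-τ)) ∂P =
      ENNReal.ofReal ((1 + l ^ α) ^ (-τ / α)) := by
  have := isProbabilityMeasure_rhoLaw h0 h1
  set X : Ω → ℝ≥0∞ := fun ω => ∫⁻ x, ENNReal.ofReal x ∂(D ω) with hX
  have hXm : Measurable X := Measurable.lintegral_kernel (by fun_prop)
  have hst (l : ℝ) (hl : 0 < l) : ∫⁻ ω, (1 + ENNReal.ofReal l * X ω) ^ (-τ) ∂P =
      ENNReal.ofReal ((1 + l ^ α) ^ (-τ / α)) := by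
    have hlog : ∫⁻ x, ENNReal.ofReal (Real.log (1 + l * max x 0)) ∂(rhoLaw α) =
        ENNReal.ofReal (1 / α * Real.log (1 + l ^ α)) := by
      rw [← lintegral_rhoLaw_log h0 h1 hl]
      refine lintegral_congr_ae ?_
      filter_upwards [rhoLaw_ae_pos α] with x hx
      rw [max_eq_left hx.le]
    have h := hD.lintegral_one_add_rpow hτ (f := fun x => l * max x 0) (by fun_prop)
      (fun x => by positivity) (by rw [hlog]; exact ENNReal.ofReal_ne_top)
    have hlα : 0 < l ^ α := by positivity
    have hnn : 0 ≤ 1 / α * Real.log (1 + l ^ α) :=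
      mul_nonneg (by positivity) (Real.log_nonneg (by linarith))
    rw [hlog, ENNReal.toReal_ofReal hnn] at h
    rw [Real.rpow_def_of_pos (by positivity)]
    convert h using 1
    · refine lintegral_congr fun ω => ?_
      simp only [hX]
      rw [← lintegral_const_mul _ (by fun_prop)]
      congr 3 with x
      rw [ENNReal.ofReal_mul hl.le, ENNReal.ofReal_max, ENNReal.ofReal_zero, max_eq_left zero_le]
    · congr 2
      ring
  have hXtop : ∀ᵐ ω ∂P, X ω ≠ ∞ := by
    have hle (l : ℝ) (hl : 0 < l) :
        ENNReal.ofReal ((1 + l ^ α) ^ (-τ / α)) ≤ P {ω | X ω ≠ ∞} := by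
      rw [← hst l hl, ← lintegral_indicator_one (show MeasurableSet {ω | X ω ≠ ∞} from
        hXm (measurableSet_singleton ∞).compl)]
      refine lintegral_mono fun ω => ?_
      by_cases hω : X ω = ∞
      · rw [hω, ENNReal.mul_top (by simpa using hl), add_top,
          ENNReal.top_rpow_of_neg (by linarith)]
        exact zero_le
      · rw [indicator_of_mem (show ω ∈ {ω | X ω ≠ ∞} from hω)]
        exact ENNReal.rpow_le_one_of_one_le_of_neg le_self_add (by linarith)
    have hlim : Tendsto (fun l : ℝ => ENNReal.ofReal ((1 + l ^ α) ^ (-τ / α))) (𝓝[>] 0) (𝓝 1) := by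
      have hc : ContinuousAt (fun l : ℝ => (1 + l ^ α) ^ (-τ / α)) 0 := by
        refine ContinuousAt.rpow_const (continuousAt_const.add
          (Real.continuousAt_rpow_const _ _ (Or.inr h0.le))) (Or.inl ?_)
        rw [Real.zero_rpow h0.ne']
        norm_num
      have := ENNReal.tendsto_ofReal (hc.tendsto.mono_left (nhdsWithin_le_nhds (s := Ioi 0)))
      simpa [Real.zero_rpow h0.ne'] using this
    have hge : 1 ≤ P {ω | X ω ≠ ∞} :=
      le_of_tendsto hlim (by filter_upwards [self_mem_nhdsWithin] with l hl using hle l hl)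
    exact (mem_ae_iff_prob_eq_one (hXm (measurableSet_singleton ∞).compl)).mpr
      (le_antisymm prob_le_one hge)
  have hX0 : ∀ᵐ ω ∂P, X ω ≠ 0 := by
    have hle (l : ℝ) (hl : 0 < l) :
        P {ω | X ω = 0} ≤ ENNReal.ofReal ((1 + l ^ α) ^ (-τ / α)) := by
      rw [← hst l hl, ← lintegral_indicator_one (show MeasurableSet {ω | X ω = 0} from
        hXm (measurableSet_singleton 0))]
      refine lintegral_mono fun ω => ?_
      by_cases hω : X ω = 0
      · rw [indicator_of_mem (show ω ∈ {ω | X ω = 0} from hω), hω]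
        simp
      · rw [indicator_of_notMem (show ω ∉ {ω | X ω = 0} from hω)]
        exact zero_le
    have hlim : Tendsto (fun l : ℝ => ENNReal.ofReal ((1 + l ^ α) ^ (-τ / α))) atTop (𝓝 0) := by
      have h2 : Tendsto (fun x : ℝ => x ^ (-τ / α)) atTop (𝓝 0) := by
        rw [neg_div]
        exact tendsto_rpow_neg_atTop (by positivity)
      have := ENNReal.tendsto_ofReal (h2.comp
        (tendsto_atTop_add_const_left _ 1 (tendsto_rpow_atTop h0)))
      simpa using this
    have hz : P {ω | X ω = 0} ≤ 0 :=
      ge_of_tendsto hlim (by filter_upwards [eventually_gt_atTop 0] with l hl using hle l hl)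
    rw [ae_iff]
    simpa using hz
  have hneg : ∀ᵐ ω ∂P, D ω (Iio 0) = 0 := by
    refine hD.ae_measure_Iio_eq_zero hτ ?_
    have := rhoLaw_ae_pos α
    rw [ae_iff] at this
    exact measure_mono_null (fun x hx => not_lt.mpr (le_of_lt hx)) this
  have hnn : ∀ᵐ ω ∂P, ∀ᵐ x ∂(D ω), 0 ≤ x := by
    filter_upwards [hneg] with ω hω
    rw [ae_iff]
    simpa [Iio] using hω
  have hmean : ∀ᵐ ω ∂P, meanFunctional D ω = (X ω).toReal := by
    filter_upwards [hnn] with ω hω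
    rw [meanFunctional, integral_eq_lintegral_of_nonneg_ae hω (by fun_prop)]
  refine ⟨?_, ?_, fun l hl => ?_⟩
  · filter_upwards [hnn, hXtop] with ω hω hωt
    exact ⟨by fun_prop, (hasFiniteIntegral_iff_ofReal hω).mpr (lt_top_iff_ne_top.mpr hωt)⟩
  · filter_upwards [hmean, hXtop, hX0] with ω h1 h2 h3
    rw [h1]
    exact ENNReal.toReal_pos h3 h2
  · rw [← hst l hl]
    refine lintegral_congr_ae ?_
    filter_upwards [hmean, hXtop] with ω h1 h2
    rw [h1, ← ENNReal.ofReal_rpow_of_pos (by positivity),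
      ENNReal.ofReal_add zero_le_one (by positivity), ENNReal.ofReal_one,
      ENNReal.ofReal_mul hl.le, ENNReal.ofReal_toReal h2]

theorem rpow_mul_prod_Gamma_add_div_Gamma {k : ℕ} (hk : 0 < k) {θ p : ℝ} (hθ : 0 < θ)
    (hp : 0 < θ + k * p) :
    (k : ℝ) ^ (k * p) * ∏ j : Fin (k - 1), (Real.Gamma ((θ + ((j : ℕ) + 1 : ℝ)) / k + p) /
      Real.Gamma ((θ + ((j : ℕ) + 1 : ℝ)) / k)) =
      Real.Gamma (θ + k * p) * Real.Gamma (θ / k) /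
        (Real.Gamma (θ / k + p) * Real.Gamma θ) := by
  have hk0 : (0 : ℝ) < k := by exact_mod_cast hk
  obtain ⟨C, hC, hG⟩ := exists_prod_Gamma_add_div_eq k hk
  have hN (x : ℝ) (hx : 0 < x) : Real.Gamma (x / k) *
      ∏ j : Fin (k - 1), Real.Gamma ((x + ((j : ℕ) + 1 : ℝ)) / k) =
      C * (k : ℝ) ^ (-x) * Real.Gamma x := by
    rw [← hG x hx, Fin.prod_univ_eq_prod_range
      (fun j => Real.Gamma ((x + ((j : ℕ) + 1 : ℝ)) / k)) (k - 1)]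
    obtain ⟨m, rfl⟩ : ∃ m, k = m + 1 := ⟨k - 1, by omega⟩
    rw [Finset.prod_range_succ', mul_comm]
    simp
  have h1 := hN θ hθ
  have h2 := hN (θ + k * p) hp
  have harg (j : ℕ) : (θ + k * p + ((j : ℕ) + 1 : ℝ)) / k = (θ + ((j : ℕ) + 1 : ℝ)) / k + p := by
    field_simp
    ring
  have harg0 : (θ + k * p) / k = θ / k + p := by field_simp
  simp_rw [harg] at h2
  rw [harg0] at h2
  rw [Finset.prod_div_distrib]
  have g1 := Real.Gamma_pos_of_pos hθ
  have g2 := Real.Gamma_pos_of_pos hp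
  have g3 := Real.Gamma_pos_of_pos (show 0 < θ / k by positivity)
  have g4 := Real.Gamma_pos_of_pos (show 0 < θ / k + p by rw [← harg0]; positivity)
  have g5 : 0 < ∏ j : Fin (k - 1), Real.Gamma ((θ + ((j : ℕ) + 1 : ℝ)) / k) :=
    Finset.prod_pos fun j _ => Real.Gamma_pos_of_pos (by positivity)
  rw [neg_add, Real.rpow_add hk0, Real.rpow_neg hk0.le (k * p)] at h2
  have hkp := Real.rpow_pos_of_pos hk0 (k * p)
  have hkθ := Real.rpow_pos_of_pos hk0 (-θ)
  set A := ∏ j : Fin (k - 1), Real.Gamma ((θ + ((j : ℕ) + 1 : ℝ)) / k)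
  set B := ∏ j : Fin (k - 1), Real.Gamma ((θ + ((j : ℕ) + 1 : ℝ)) / k + p)
  have hA : A = C * (k : ℝ) ^ (-θ) * Real.Gamma θ / Real.Gamma (θ / k) := by
    rw [← h1]
    field_simp
  have hB : B = C * ((k : ℝ) ^ (-θ) * ((k : ℝ) ^ (k * p))⁻¹) * Real.Gamma (θ + k * p) /
      Real.Gamma (θ / k + p) := by
    rw [← h2]
    field_simp
  rw [hA, hB]
  field_simp

theorem lintegral_rpow_pow_mul_prod_gamma {Ω : Type*} [MeasurableSpace Ω] {P : Measure Ω}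
    [IsProbabilityMeasure P] {n k : ℕ} (hk : 0 < k) {a : Fin n → ℝ} (ha : ∀ j, 0 < a j)
    {G : Fin n → Ω → ℝ}
    (hG : ∀ j, HasLaw (G j) (gammaMeasure (a j) 1) P) (hi : iIndepFun G P) {p : ℝ}
    (hp : ∀ j, 0 < a j + p) :
    ∫⁻ ω, ENNReal.ofReal (((k : ℝ) ^ k * ∏ j, G j ω) ^ p) ∂P =
      ENNReal.ofReal ((k : ℝ) ^ (k * p) *
        ∏ j, (Real.Gamma (a j + p) / Real.Gamma (a j))) := by
  have hprob := fun j => isProbabilityMeasure_gammaMeasure (ha j) one_pos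
  have hk0 : (0 : ℝ) < k := by exact_mod_cast hk
  have hpos : ∀ᵐ ω ∂P, ∀ j, 0 < G j ω := by
    rw [ae_all_iff]
    intro j
    exact ((hG j).ae_iff (p := fun x => 0 < x) measurableSet_Ioi.mem).mpr (gammaMeasure_ae_pos _)
  have hfac : ∫⁻ ω, ENNReal.ofReal (((k : ℝ) ^ k * ∏ j, G j ω) ^ p) ∂P =
      ∫⁻ ω, ENNReal.ofReal ((k : ℝ) ^ (k * p)) * ∏ j, ENNReal.ofReal (G j ω ^ p) ∂P := by
    refine lintegral_congr_ae ?_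
    filter_upwards [hpos] with ω hω
    rw [Real.mul_rpow (by positivity) (Finset.prod_nonneg fun j _ => (hω j).le),
      ENNReal.ofReal_mul (by positivity), ← Real.rpow_natCast, ← Real.rpow_mul hk0.le,
      ← Real.finsetProd_rpow _ _ fun j _ => (hω j).le,
      ENNReal.ofReal_prod_of_nonneg fun j _ => Real.rpow_nonneg (hω j).le _]
  have hlaw : HasLaw (fun ω j => G j ω) (Measure.pi fun j => gammaMeasure (a j) 1) P :=
    hi.hasLaw_pi hG
  rw [hfac, lintegral_const_mul' _ _ ENNReal.ofReal_ne_top,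
    hlaw.lintegral_comp (f := fun g => ∏ j, ENNReal.ofReal (g j ^ p))
      (Measurable.aemeasurable (by fun_prop)),
    lintegral_pi_prod _ (fun _ x => ENNReal.ofReal (x ^ p)) fun _ => by fun_prop,
    ENNReal.ofReal_mul (by positivity), ENNReal.ofReal_prod_of_nonneg fun j _ =>
      (div_pos (Real.Gamma_pos_of_pos (hp j)) (Real.Gamma_pos_of_pos (ha j))).le]
  congr 1
  exact Finset.prod_congr rfl fun j _ => lintegral_rpow_gammaMeasure (ha j) (hp j)

theorem ProbabilityTheory.IdentDistrib.mul_of_indepFun {Ω Ω' : Type*} [MeasurableSpace Ω] [MeasurableSpace Ω']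
    {P : Measure Ω} {P' : Measure Ω'} [IsFiniteMeasure P] [IsFiniteMeasure P']
    {X Y : Ω → ℝ} {X' Y' : Ω' → ℝ} (hX : IdentDistrib X X' P P') (hY : IdentDistrib Y Y' P P')
    (h : IndepFun X Y P) (h' : IndepFun X' Y' P') :
    IdentDistrib (fun ω => X ω * Y ω) (fun ω => X' ω * Y' ω) P P' :=
  (hX.prodMk hY h h').comp (u := fun z : ℝ × ℝ => z.1 * z.2) (by fun_prop)

theorem IsPositiveStableLaw.identDistrib_mean_ratio {Ω Ω' : Type*} [MeasurableSpace Ω]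
    [MeasurableSpace Ω'] {P : Measure Ω} [IsProbabilityMeasure P] {P' : Measure Ω'}
    [IsProbabilityMeasure P'] {α τ : ℝ} (h0 : 0 < α) (h1 : α < 1) (hτ : 0 < τ) {ν : Measure ℝ}
    (hν : IsPositiveStableLaw α ν) {D : Kernel Ω ℝ} (hD : IsDirichletProcess τ (rhoLaw α) D P)
    {S T : Ω' → ℝ} (hS : HasLaw S ν P') (hT : HasLaw T (polynomialTilt τ ν) P')
    (hST : IndepFun S T P') :
    IdentDistrib (meanFunctional D) (fun ω => S ω / T ω) P P' := by
  have := hν.isProbabilityMeasure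
  have := hν.isProbabilityMeasure_polynomialTilt h0 hτ
  obtain ⟨-, hpos, hst⟩ := hD.meanFunctional_rhoLaw hτ h0 h1
  have := hD.1
  have hmm : AEMeasurable (meanFunctional D) P :=
    (stronglyMeasurable_id.integral_kernel (κ := D)).measurable.aemeasurable
  have hSa := hS.aemeasurable
  have hTa := hT.aemeasurable
  have hQm : AEMeasurable (fun ω => S ω / T ω) P' := hSa.div hTa
  have hpair : HasLaw (fun ω => (S ω, T ω)) (ν.prod (polynomialTilt τ ν)) P' :=
    ⟨hSa.prodMk hTa, by
      rw [(indepFun_iff_map_prod_eq_prod_map_map hSa hTa).mp hST, hS.map_eq, hT.map_eq]⟩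
  have hSpos : ∀ᵐ ω ∂P', 0 < S ω :=
    (hS.ae_iff (p := fun x => 0 < x) measurableSet_Ioi.mem).mpr (hν.ae_pos h0)
  have hTpos : ∀ᵐ ω ∂P', 0 < T ω :=
    (hT.ae_iff (p := fun x => 0 < x) measurableSet_Ioi.mem).mpr
      (polynomialTilt_ae_pos _ (hν.ae_pos h0))
  refine ⟨hmm, hQm, ?_⟩
  have := Measure.isProbabilityMeasure_map hmm (μ := P)
  have := Measure.isProbabilityMeasure_map hQm (μ := P')
  refine ext_of_generalizedStieltjes ?_ ?_ hτ (fun l hl => ?_) fun p hp => ?_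
  · exact (ae_map_iff hmm measurableSet_Ioi).mpr hpos
  · refine (ae_map_iff hQm measurableSet_Ioi).mpr ?_
    filter_upwards [hSpos, hTpos] with ω h1 h2 using div_pos h1 h2
  · rw [lintegral_map' (by fun_prop) hmm, hst l hl, lintegral_map' (by fun_prop) hQm,
      ← hν.lintegral_ratio h0 hτ hl]
    exact (hpair.lintegral_comp (f := fun z => ENNReal.ofReal ((1 + l * (z.1 / z.2)) ^ (-τ)))
      (by fun_prop)).symm
  · rw [lintegral_map' (by fun_prop) hQm]
    have h2 : ∫⁻ ω, ENNReal.ofReal ((S ω / T ω) ^ (-p)) ∂P' =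
        ∫⁻ ω, ENNReal.ofReal (S ω ^ (-p)) * ENNReal.ofReal (T ω ^ (-(-p))) ∂P' := by
      refine lintegral_congr_ae ?_
      filter_upwards [hSpos, hTpos] with ω h1 h2
      rw [← ENNReal.ofReal_mul (by positivity), Real.div_rpow h1.le h2.le, Real.rpow_neg h2.le (-p),
        div_eq_mul_inv]
    rw [h2, hpair.lintegral_comp
      (f := fun z => ENNReal.ofReal (z.1 ^ (-p)) * ENNReal.ofReal (z.2 ^ (-(-p)))) (by fun_prop),
      lintegral_prod_mul (f := fun x => ENNReal.ofReal (x ^ (-p)))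
        (g := fun x => ENNReal.ofReal (x ^ (-(-p)))) (by fun_prop) (by fun_prop),
      hν.lintegral_polynomialTilt_rpow h0]
    refine ENNReal.mul_ne_top (hν.lintegral_rpow_neg_ne_top h0 hp.1) (ENNReal.mul_ne_top ?_ ?_)
    · exact ENNReal.inv_ne_top.mpr (hν.lintegral_rpow_neg_ne_zero h0 hτ)
    · exact hν.lintegral_rpow_neg_ne_top h0 (by linarith [hp.2])

theorem IsPositiveStableLaw.identDistrib_one_div_tilt {k : ℕ} (hk : 0 < k) {θ : ℝ} (hθ : 0 < θ)
    {ν : Measure ℝ} (hν : IsPositiveStableLaw (1 / (k : ℝ)) ν) {Ω Ω' : Type*} [MeasurableSpace Ω]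
    [MeasurableSpace Ω'] {P : Measure Ω} [IsProbabilityMeasure P] {P' : Measure Ω'}
    [IsProbabilityMeasure P'] {T : Ω → ℝ} (hT : HasLaw T (polynomialTilt (θ / k) ν) P)
    {G : Fin (k - 1) → Ω' → ℝ}
    (hG : ∀ j, HasLaw (G j) (gammaMeasure ((θ + ((j : ℕ) + 1 : ℝ)) / k) 1) P')
    (hi : iIndepFun G P') :
    IdentDistrib (fun ω => 1 / T ω) (fun ω => (k : ℝ) ^ k * ∏ j, G j ω) P P' := by
  have hk0 : (0 : ℝ) < k := by exact_mod_cast hk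
  have hα : (0 : ℝ) < 1 / k := by positivity
  have hτ : 0 < θ / k := by positivity
  have hTm : AEMeasurable (fun ω => 1 / T ω) P := hT.aemeasurable.const_div 1
  have hGm : AEMeasurable (fun ω => (k : ℝ) ^ k * ∏ j, G j ω) P' :=
    (Finset.aemeasurable_fun_prod _ fun j _ => (hG j).aemeasurable).const_mul _
  have hTpos : ∀ᵐ ω ∂P, 0 < T ω :=
    (hT.ae_iff (p := fun x => 0 < x) measurableSet_Ioi.mem).mpr
      (polynomialTilt_ae_pos _ (hν.ae_pos hα))
  have hGpos : ∀ᵐ ω ∂P', ∀ j, 0 < G j ω := by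
    rw [ae_all_iff]
    intro j
    exact ((hG j).ae_iff (p := fun x => 0 < x) measurableSet_Ioi.mem).mpr (gammaMeasure_ae_pos _)
  have hval (p : ℝ) (hp : p ∈ Ioo (-(θ / k)) 0) :
      ∫⁻ x, ENNReal.ofReal (x ^ p) ∂(P.map fun ω => 1 / T ω) =
      ENNReal.ofReal (Real.Gamma (θ + k * p) * Real.Gamma (θ / k) /
        (Real.Gamma (θ / k + p) * Real.Gamma θ)) := by
    have hq : 0 < θ / k + p := by linarith [hp.1]
    have h1 : ∫⁻ ω, ENNReal.ofReal ((1 / T ω) ^ p) ∂P =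
        ∫⁻ ω, ENNReal.ofReal (T ω ^ (-p)) ∂P := by
      refine lintegral_congr_ae ?_
      filter_upwards [hTpos] with ω hω
      rw [one_div, Real.inv_rpow hω.le, Real.rpow_neg hω.le]
    have e1 : θ / k / (1 / (k : ℝ)) = θ := by field_simp
    have e2 : (θ / k + p) / (1 / (k : ℝ)) = θ + k * p := by field_simp
    have g1 := Real.Gamma_pos_of_pos hθ
    have g2 := Real.Gamma_pos_of_pos (show 0 < θ + k * p by rw [← e2]; positivity)
    have g3 := Real.Gamma_pos_of_pos hτ
    have g4 := Real.Gamma_pos_of_pos hq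
    rw [lintegral_map' (by fun_prop) hTm, h1,
      hT.lintegral_comp (f := fun x => ENNReal.ofReal (x ^ (-p))) (by fun_prop),
      hν.lintegral_polynomialTilt_rpow hα, hν.lintegral_rpow_neg hα hτ,
      hν.lintegral_rpow_neg hα hq, e1, e2, ← ENNReal.ofReal_inv_of_pos (by positivity),
      ← ENNReal.ofReal_mul (by positivity)]
    congr 1
    field_simp
  have := Measure.isProbabilityMeasure_map hTm (μ := P)
  have := Measure.isProbabilityMeasure_map hGm (μ := P')
  refine ⟨hTm, hGm, ext_of_mellin_eqOn_Ioo ?_ ?_ (neg_lt_zero.mpr hτ) (fun p hp => ?_)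
    fun p hp => ?_⟩
  · refine (ae_map_iff hTm measurableSet_Ioi).mpr ?_
    filter_upwards [hTpos] with ω hω using one_div_pos.mpr hω
  · refine (ae_map_iff hGm measurableSet_Ioi).mpr ?_
    filter_upwards [hGpos] with ω hω
    exact mul_pos (by positivity) (Finset.prod_pos fun j _ => hω j)
  · have hq : 0 < θ / k + p := by linarith [hp.1]
    have hkp : 0 < θ + k * p := by
      have := mul_pos hk0 hq
      rwa [mul_add, mul_div_cancel₀ _ hk0.ne'] at this
    rw [hval p hp, lintegral_map' (by fun_prop) hGm,
      lintegral_rpow_pow_mul_prod_gamma hk (fun j => by positivity) hG hi fun j => ?_,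
      rpow_mul_prod_Gamma_add_div_Gamma hk hθ hkp]
    have : 0 < ((j : ℕ) + 1 : ℝ) / k := by positivity
    rw [add_div]
    linarith
  · rw [hval p hp]
    exact ENNReal.ofReal_ne_top

theorem proposition4p4 (k : ℕ) (hk : 2 ≤ k) (θ : ℝ) (hθ : 0 < θ)
    -- the law of `S_{1/k}`
    (ν : Measure ℝ) (hν : IsPositiveStableLaw (1 / (k : ℝ)) ν)
    -- a Dirichlet process with shape parameter `(θ/k) ϱ_{1/k}`; its mean is `M_{θ/k}(ϱ_{1/k})`
    {Ω₀ : Type*} [MeasurableSpace Ω₀] (P₀ : Measure Ω₀) [IsProbabilityMeasure P₀]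
    (D : Kernel Ω₀ ℝ) (hD : IsDirichletProcess (θ / k) (rhoLaw (1 / (k : ℝ))) D P₀)
    -- independent random variables `S = S_{1/k}` and `T = T_{1/k,θ/k}`
    {Ω₁ : Type*} [MeasurableSpace Ω₁] (P₁ : Measure Ω₁) [IsProbabilityMeasure P₁]
    (S T : Ω₁ → ℝ) (hS : HasLaw S ν P₁) (hT : HasLaw T (polynomialTilt (θ / k) ν) P₁)
    (hST : IndepFun S T P₁)
    -- independent random variables `S' = S_{1/k}` and `G j = G_{(θ+j+1)/k}` for `0 ≤ j < k - 1`
    {Ω₂ : Type*} [MeasurableSpace Ω₂] (P₂ : Measure Ω₂) [IsProbabilityMeasure P₂]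
    (S' : Ω₂ → ℝ) (G : Fin (k - 1) → Ω₂ → ℝ) (hS' : HasLaw S' ν P₂)
    (hG : ∀ j, HasLaw (G j) (gammaMeasure ((θ + ((j : ℕ) + 1 : ℝ)) / k) 1) P₂)
    (hGindep : iIndepFun G P₂) (hSG : IndepFun S' (fun ω j => G j ω) P₂) :
    (∀ᵐ ω ∂P₀, Integrable (fun x : ℝ => x) (D ω)) ∧
    IdentDistrib (meanFunctional D) (fun ω => S ω / T ω) P₀ P₁ ∧
    IdentDistrib (fun ω => S ω / T ω) (fun ω => (k : ℝ) ^ k * S' ω * ∏ j, G j ω) P₁ P₂ ∧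
    IdentDistrib (fun ω => 1 / T ω) (fun ω => (k : ℝ) ^ k * ∏ j, G j ω) P₁ P₂ := by
  have hk0 : (0 : ℝ) < k := by positivity
  have hk1 : 1 / (k : ℝ) < 1 := by
    rw [div_lt_one hk0]
    exact_mod_cast hk
  have hα : 0 < 1 / (k : ℝ) := by positivity
  have hτ : 0 < θ / k := by positivity
  have hinv := hν.identDistrib_one_div_tilt (by omega) hθ hT hG hGindep
  have hSS : IdentDistrib S S' P₁ P₂ :=
    ⟨hS.aemeasurable, hS'.aemeasurable, by rw [hS.map_eq, hS'.map_eq]⟩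
  refine ⟨(hD.meanFunctional_rhoLaw hτ hα hk1).1,
    hν.identDistrib_mean_ratio hα hk1 hτ hD hS hT hST, ?_, hinv⟩
  have hind : IndepFun S (fun ω => 1 / T ω) P₁ :=
    hST.comp (φ := fun x => x) (ψ := fun t => 1 / t) measurable_id (by fun_prop)
  have hind' : IndepFun S' (fun ω => (k : ℝ) ^ k * ∏ j, G j ω) P₂ :=
    hSG.comp (φ := fun x => x) (ψ := fun g : Fin (k - 1) → ℝ => (k : ℝ) ^ k * ∏ j, g j)
      measurable_id (by fun_prop)
  have h := IdentDistrib.mul_of_indepFun hSS hinv hind hind'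
  have e1 : (fun ω => S ω / T ω) = fun ω => S ω * (1 / T ω) := by
    funext ω
    rw [mul_one_div]
  have e2 : (fun ω => (k : ℝ) ^ k * S' ω * ∏ j, G j ω) =
      fun ω => S' ω * ((k : ℝ) ^ k * ∏ j, G j ω) := by
    funext ω
    ring
  rw [e1, e2]
  exact h
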